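/- Let $C=\mathbb H/\langle z\mapsto z+1\rangle$ be the hyperbolic cylinder with a cusp at $\operatorname{Im} z\to\infty$. For an integer $p\ge 1$, a $p$-sided polygonal cusp is a connected open subset $D\subset C$ that contains $\{\operatorname{Im} z>c\}$ for some $c$, is contained in $\{\operatorname{Im} z\ge\varepsilon\}$ for some $\varepsilon>0$, and whose boundary is a simple closed curve, winding once around $C$, made of $p$ nondegenerate geodesic segments (the sides; an interior angle equal to $\pi$ at a vertex is allowed). Its perimeter is the sum of the lengths of its sides, its area is the hyperbolic area of $D$, and it is called regular if all its sides have the same length and all its interior angles are equal. Theorem. Let $p\ge 1$ be an integer and $L>0$. There is a regular $p$-sided polygonal cusp with perimeter $L$. Every regular $p$-sided polygonal cusp with perimeter $L$ has all its interior angles equal to $$\theta=2\arcsin\left(\frac{2e^{L/(2p)}}{1+e^{L/p}}\right),$$ and it has the maximum area among all $p$-sided polygonal cusps with perimeter $L$. Moreover, a $p$-sided polygonal cusp with perimeter $L$ that has this maximum area is regular. -/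

import Mathlib

open UpperHalfPlane MeasureTheory

noncomputable section

/-- The geodesic segment of the hyperbolic plane with endpoints `z` and `w`: the points at which
equality holds in the triangle inequality. -/
def geodesicSegment (z w : ℍ) : Set ℍ :=
  {u | dist z u + dist u w = dist z w}

/-- A tangent vector at `z` (as a complex number) pointing along the geodesic from `z` to `w`,
for `w ≠ z`. The Cayley transform `u ↦ (u - z) / (u - conj z)` sends `z` to the centre of the
unit disc, where the geodesics through the centre are diameters, and its derivative at `z` is a
positive multiple of `-I`. Hence the direction at `z` is a positive multiple of
`I * (w - z) / (w - conj z)`. -/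
def geodesicDirection (z w : ℍ) : ℂ :=
  Complex.I * (((w : ℂ) - (z : ℂ)) / ((w : ℂ) - (starRingEnd ℂ) (z : ℂ)))

/-- A `p`-sided polygonal cusp: a neighbourhood of the cusp in the parabolic cylinder
`ℍ / ⟨T⟩`, `T z = z + 1`, whose boundary is a simple closed curve made of `p` geodesic segments.

Subsets of the cylinder are described by their full (that is, `T`-invariant) preimages in `ℍ`,
and the boundary curve by its lift to `ℍ`, an infinite `T`-invariant polygonal path with vertices
`vertex i`, `i : ℤ`, traversed in the direction of `T`, so that the region lies on its left. -/
structure PolygonalCusp (p : ℕ) where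
  /-- the successive vertices of the lifted boundary curve -/
  vertex : ℤ → ℍ
  /-- the preimage in `ℍ` of the (open) polygonal cusp -/
  region : Set ℍ
  /-- the boundary curve closes up in the cylinder after `p` sides and winds once around it -/
  vertex_add : ∀ i : ℤ, vertex (i + p) = (1 : ℝ) +ᵥ vertex i
  /-- the sides are nondegenerate -/
  vertex_ne : ∀ i : ℤ, vertex i ≠ vertex (i + 1)
  /-- the boundary curve is simple: the sides without their final endpoints are disjoint -/
  simple : Pairwise fun i j : ℤ =>
    Disjoint (geodesicSegment (vertex i) (vertex (i + 1)) \ {vertex (i + 1)})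
      (geodesicSegment (vertex j) (vertex (j + 1)) \ {vertex (j + 1)})
  /-- the region is invariant under `T` -/
  vadd_mem_region : ∀ z : ℍ, (1 : ℝ) +ᵥ z ∈ region ↔ z ∈ region
  isOpen_region : IsOpen region
  isConnected_region : IsConnected region
  /-- the region contains a horocyclic neighbourhood of the cusp -/
  mem_region_of_lt_im : ∃ c : ℝ, ∀ z : ℍ, c < z.im → z ∈ region
  /-- the cusp is the only end of the region: it stays away from the other end of the cylinder -/
  im_ge_of_mem_region : ∃ ε : ℝ, 0 < ε ∧ ∀ z ∈ region, ε ≤ z.im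
  /-- the boundary of the region is the polygonal curve -/
  frontier_region : frontier region = ⋃ i : ℤ, geodesicSegment (vertex i) (vertex (i + 1))

namespace PolygonalCusp

variable {p : ℕ}

/-- The length of the side from `vertex i` to `vertex (i + 1)`. -/
def sideLength (P : PolygonalCusp p) (i : ℤ) : ℝ :=
  dist (P.vertex i) (P.vertex (i + 1))

/-- The sum of the lengths of the `p` sides. -/
def perimeter (P : PolygonalCusp p) : ℝ :=
  ∑ i ∈ Finset.range p, P.sideLength i

/-- The interior angle at `vertex i`, in `[0, 2π)`: the angle swept counterclockwise from the
direction of the next side to the direction of the previous side. -/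
def interiorAngle (P : PolygonalCusp p) (i : ℤ) : ℝ :=
  toIcoMod Real.two_pi_pos 0
    (Complex.arg (geodesicDirection (P.vertex i) (P.vertex (i - 1)) /
      geodesicDirection (P.vertex i) (P.vertex (i + 1))))

/-- The hyperbolic area of the polygonal cusp, computed in the fundamental domain
`0 ≤ re z < 1` of `T`; `volume` on `ℍ` is the hyperbolic measure `dx dy / y ^ 2`. -/
def area (P : PolygonalCusp p) : ENNReal :=
  volume (P.region ∩ {z : ℍ | 0 ≤ z.re ∧ z.re < 1})

/-- All sides have the same length and all interior angles are equal. -/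
def IsRegular (P : PolygonalCusp p) : Prop :=
  (∀ i j : ℤ, P.sideLength i = P.sideLength j) ∧
    ∀ i j : ℤ, P.interiorAngle i = P.interiorAngle j

end PolygonalCusp

end

/-!
A polygonal cusp of perimeter `L` has area at most `p * sideArea (L / p)`, where
`sideArea l = 2 * arctan (sinh (l / 2))`, and only the regular ones attain this bound.

*The inequality.* The region stays away from the real axis, so a vertical half-line going down from
a point of the region meets the boundary: the region is contained in the union of the sets of points
above the sides. Above a side with endpoints `z` and `w` there is the ideal triangle with
vertices `z`, `w` and `∞`, of area
`2 * arctan (|w.re - z.re| / (z.im + w.im)) ≤ sideArea (dist z w)`, with equality if and only if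
`z.im = w.im`. The function `sideArea` is strictly concave on `[0, ∞)`, so Jensen's inequality
bounds the sum over one period of sides, with equality if and only if the sides have equal
lengths (`PolygonalCusp.area_le`).

*The equality case.* The vertices have equal heights and the horizontal displacements of the sides
have equal absolute values. As the boundary is simple, the displacements also have the same sign:
each vertex is the translate of the preceding one by `1 / p`
(`PolygonalCusp.isTranslational_of_le_area`).

*Regular cusps.* If all sides and all angles are equal, some real Möbius transformation `g` maps
every vertex to the next one. On the vertices it commutes with `T`, which forces `g` to be the
translation by `1 / p` (`PolygonalCusp.IsRegular.isTranslational`). For a cusp of this form the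
boundary is the graph of a function and the region is the set of points above it, so the area is
exactly `p * sideArea (L / p)` (`PolygonalCusp.IsTranslational.area_eq`), and the angle is computed
from coordinates (`PolygonalCusp.IsTranslational.interiorAngle_eq`).

*Existence.* The exterior of the closed discs of centres `(i + 1 / 2) / p` and a common radius
larger than `1 / (2 * p)` is the preimage of such a cusp (`PolygonalCusp.horocyclicCusp`).
-/

/-! ### Geodesic segments -/

namespace UpperHalfPlane

theorem sinh_half_dist_sq (z w : ℍ) :
    Real.sinh (dist z w / 2) ^ 2 =
      ((z.re - w.re) ^ 2 + (z.im - w.im) ^ 2) / (4 * z.im * w.im) := by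
  have h1 := z.im_pos
  have h2 := w.im_pos
  have h := cosh_dist' z w
  have h3 := Real.cosh_sq (dist z w / 2)
  have h4 := Real.cosh_two_mul (dist z w / 2)
  rw [mul_div_cancel₀ _ (two_ne_zero' ℝ), h] at h4
  have h5 : Real.sinh (dist z w / 2) ^ 2 =
      (((z.re - w.re) ^ 2 + z.im ^ 2 + w.im ^ 2) / (2 * z.im * w.im) - 1) / 2 := by linarith
  rw [h5]
  field_simp
  ring

/-- Three points with equality in the triangle inequality lie on a common circle centred on the
real axis, or on a common vertical line. The hyperbolic Gram determinant of the three points is,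
up to a nonzero factor, the square of the determinant of the rows `(1, re, re ^ 2 + im ^ 2)`. -/
theorem collinear_of_mem_geodesicSegment {z w u : ℍ} (hu : u ∈ geodesicSegment z w) :
    (u.re - z.re) * (w.re ^ 2 + w.im ^ 2 - (z.re ^ 2 + z.im ^ 2)) =
      (w.re - z.re) * (u.re ^ 2 + u.im ^ 2 - (z.re ^ 2 + z.im ^ 2)) := by
  have h1 := z.im_pos
  have h2 := w.im_pos
  have h3 := u.im_pos
  have hu' : dist z u + dist u w = dist z w := hu
  have hC := Real.cosh_add (dist z u) (dist u w)
  rw [hu'] at hC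
  have hS : (Real.cosh (dist z w) - Real.cosh (dist z u) * Real.cosh (dist u w)) ^ 2 =
      (Real.cosh (dist z u) ^ 2 - 1) * (Real.cosh (dist u w) ^ 2 - 1) := by
    rw [hC, Real.cosh_sq, Real.cosh_sq]
    ring
  rw [cosh_dist', cosh_dist', cosh_dist'] at hS
  have key : u.im ^ 2 * ((u.re - z.re) * (w.re ^ 2 + w.im ^ 2 - (z.re ^ 2 + z.im ^ 2)) -
      (w.re - z.re) * (u.re ^ 2 + u.im ^ 2 - (z.re ^ 2 + z.im ^ 2))) ^ 2 = 0 := by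
    field_simp at hS
    linear_combination (-1 / 4 : ℝ) * hS
  have := pow_eq_zero_iff (two_ne_zero) |>.1 ((mul_eq_zero.1 key).resolve_left (by positivity))
  linarith

/-- On a half-circle centred on the real axis, `arsinh ((re - c) / im)` is an arc length
parameter. -/
theorem dist_eq_of_mem_circle {c : ℝ} {z w : ℍ}
    (h : (z.re - c) ^ 2 + z.im ^ 2 = (w.re - c) ^ 2 + w.im ^ 2) :
    dist z w = |Real.arsinh ((z.re - c) / z.im) - Real.arsinh ((w.re - c) / w.im)| := by
  have h1 := z.im_pos
  have h2 := w.im_pos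
  refine Real.cosh_strictMonoOn.injOn (Set.mem_Ici.2 dist_nonneg) (Set.mem_Ici.2 (abs_nonneg _)) ?_
  have hr : ∀ v : ℍ, (v.re - c) ^ 2 + v.im ^ 2 = (w.re - c) ^ 2 + w.im ^ 2 →
      √(1 + ((v.re - c) / v.im) ^ 2) = √((w.re - c) ^ 2 + w.im ^ 2) / v.im := by
    intro v hv
    have := v.im_pos
    rw [← hv, ← Real.sqrt_sq this.le, ← Real.sqrt_div' _ (sq_nonneg _), Real.sqrt_sq this.le]
    congr 1
    field_simp
    ring
  rw [Real.cosh_abs, Real.cosh_sub, Real.cosh_arsinh, Real.cosh_arsinh, Real.sinh_arsinh,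
    Real.sinh_arsinh, hr z h, hr w rfl, cosh_dist']
  have hs := Real.sq_sqrt (show 0 ≤ (w.re - c) ^ 2 + w.im ^ 2 by positivity)
  field_simp
  rw [hs]
  linear_combination h

theorem arsinh_lt_arsinh_of_mem_circle {c : ℝ} {z w : ℍ}
    (h : (z.re - c) ^ 2 + z.im ^ 2 = (w.re - c) ^ 2 + w.im ^ 2) (hzw : z.re < w.re) :
    Real.arsinh ((z.re - c) / z.im) < Real.arsinh ((w.re - c) / w.im) := by
  have h1 := z.im_pos
  have h2 := w.im_pos
  rw [Real.arsinh_lt_arsinh, div_lt_div_iff₀ h1 h2]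
  rcases le_or_gt c z.re with h3 | h3
  · have : w.im < z.im := by nlinarith
    nlinarith
  · rcases le_or_gt c w.re with h4 | h4
    · nlinarith [mul_pos (sub_pos.2 h3) h2, mul_nonneg (sub_nonneg.2 h4) h1.le]
    · have : z.im < w.im := by nlinarith
      nlinarith

/-- The centre on the real axis of the half-circle through `z` and `w`, if `z.re ≠ w.re`. -/
noncomputable def geodesicCenter (z w : ℍ) : ℝ :=
  (w.re ^ 2 + w.im ^ 2 - (z.re ^ 2 + z.im ^ 2)) / (2 * (w.re - z.re))

theorem geodesicCenter_spec {z w : ℍ} (h : z.re ≠ w.re) :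
    (z.re - geodesicCenter z w) ^ 2 + z.im ^ 2 = (w.re - geodesicCenter z w) ^ 2 + w.im ^ 2 := by
  have : w.re - z.re ≠ 0 := sub_ne_zero.2 h.symm
  have h2 : geodesicCenter z w * (2 * (w.re - z.re)) =
      w.re ^ 2 + w.im ^ 2 - (z.re ^ 2 + z.im ^ 2) := by
    rw [geodesicCenter, div_mul_cancel₀]
    positivity
  linear_combination h2

theorem mem_circle_of_mem_geodesicSegment {z w u : ℍ} (h : z.re ≠ w.re)
    (hu : u ∈ geodesicSegment z w) :
    (u.re - geodesicCenter z w) ^ 2 + u.im ^ 2 =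
      (z.re - geodesicCenter z w) ^ 2 + z.im ^ 2 := by
  have h1 := collinear_of_mem_geodesicSegment hu
  have h2 := geodesicCenter_spec h
  have h3 : w.re - z.re ≠ 0 := sub_ne_zero.2 h.symm
  refine mul_left_cancel₀ h3 ?_
  linear_combination -h1 - (u.re - z.re) * h2

theorem geodesicSegment_comm (z w : ℍ) : geodesicSegment z w = geodesicSegment w z := by
  ext u
  simp only [geodesicSegment, Set.mem_ofPred_eq, dist_comm w, dist_comm _ z, add_comm (dist z u)]

theorem left_mem_geodesicSegment (z w : ℍ) : z ∈ geodesicSegment z w := by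
  simp [geodesicSegment]

theorem mem_geodesicSegment_of_lt {z w u : ℍ} (h : z.re < w.re)
    (hu : u ∈ geodesicSegment z w) : z.re ≤ u.re ∧ u.re ≤ w.re := by
  have h1 := mem_circle_of_mem_geodesicSegment h.ne hu
  have h2 := geodesicCenter_spec h.ne
  have hu' : dist z u + dist u w = dist z w := hu
  rw [dist_eq_of_mem_circle h1.symm, dist_eq_of_mem_circle (h1.trans h2),
    dist_eq_of_mem_circle h2] at hu'
  have h3 := arsinh_lt_arsinh_of_mem_circle h2 h
  rw [abs_of_neg (sub_neg.2 h3)] at hu'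
  constructor <;> by_contra! hlt
  · have h4 := arsinh_lt_arsinh_of_mem_circle h1 hlt
    rw [abs_of_pos (sub_pos.2 h4), abs_of_neg (sub_neg.2 (h4.trans h3))] at hu'
    linarith
  · have h4 := arsinh_lt_arsinh_of_mem_circle (h1.trans h2).symm hlt
    rw [abs_of_neg (sub_neg.2 (h3.trans h4)), abs_of_pos (sub_pos.2 h4)] at hu'
    linarith

theorem re_eq_of_mem_geodesicSegment {z w u : ℍ} (h : z.re = w.re)
    (hu : u ∈ geodesicSegment z w) : u.re = z.re := by
  have h1 := collinear_of_mem_geodesicSegment hu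
  have hz := z.im_pos
  have hw := w.im_pos
  by_cases him : z.im = w.im
  · obtain rfl : z = w := ext_re_im h him
    have hu' : dist z u + dist u z = dist z z := hu
    rw [dist_self, dist_comm u z] at hu'
    have : dist z u = 0 := by linarith
    rw [dist_eq_zero.1 this]
  · rw [h, sub_self, zero_mul, mul_eq_zero] at h1
    rcases h1 with h1 | h1
    · linarith
    · exact absurd (by nlinarith) him

/-- A point of the half-circle through `z` and `w` whose real part is between those of `z` and `w`
is on the geodesic segment. -/
theorem mem_geodesicSegment_of_circle {c : ℝ} {z w u : ℍ}
    (hw : (w.re - c) ^ 2 + w.im ^ 2 = (z.re - c) ^ 2 + z.im ^ 2)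
    (hu : (u.re - c) ^ 2 + u.im ^ 2 = (z.re - c) ^ 2 + z.im ^ 2)
    (hzu : z.re ≤ u.re) (huw : u.re ≤ w.re) : u ∈ geodesicSegment z w := by
  have mono : ∀ {a b : ℍ}, (a.re - c) ^ 2 + a.im ^ 2 = (z.re - c) ^ 2 + z.im ^ 2 →
      (b.re - c) ^ 2 + b.im ^ 2 = (z.re - c) ^ 2 + z.im ^ 2 → a.re ≤ b.re →
      Real.arsinh ((a.re - c) / a.im) ≤ Real.arsinh ((b.re - c) / b.im) := by
    intro a b ha hb hab
    rcases hab.eq_or_lt with h | h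
    · have : a = b := ext_re_im h (by
        have := a.im_pos
        have := b.im_pos
        rw [h] at ha
        nlinarith)
      rw [this]
    · exact (arsinh_lt_arsinh_of_mem_circle (ha.trans hb.symm) h).le
  have m1 := mono rfl hu hzu
  have m2 := mono hu hw huw
  change dist z u + dist u w = dist z w
  rw [dist_eq_of_mem_circle hu.symm, dist_eq_of_mem_circle (hu.trans hw.symm),
    dist_eq_of_mem_circle hw.symm, abs_of_nonpos (by linarith), abs_of_nonpos (by linarith),
    abs_of_nonpos (by linarith)]
  ring

end UpperHalfPlane

/-! ### The area above a geodesic segment -/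

namespace UpperHalfPlane

theorem lintegral_Ioi_one_div_sq {h : ℝ} (hh : 0 < h) :
    ∫⁻ y in Set.Ioi h, ((1 / ‖y‖₊) ^ 2 : NNReal) = ENNReal.ofReal (1 / h) := by
  have h1 : ∫⁻ y in Set.Ioi h, ((1 / ‖y‖₊) ^ 2 : NNReal) =
      ∫⁻ y in Set.Ioi h, ENNReal.ofReal (y ^ (-2 : ℝ)) := by
    refine setLIntegral_congr_fun measurableSet_Ioi fun y hy => ?_
    have hy' : 0 < y := hh.trans hy
    rw [ENNReal.ofReal, ENNReal.coe_inj]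
    ext
    rw [Real.coe_toNNReal _ (by positivity), Real.rpow_neg hy'.le]
    simp
  rw [h1, ← ofReal_integral_eq_lintegral_ofReal
    (integrableOn_Ioi_rpow_of_lt (by norm_num) hh)
    ((ae_restrict_mem measurableSet_Ioi).mono fun y hy => Real.rpow_nonneg (hh.trans hy).le _),
    integral_Ioi_rpow_of_lt (by norm_num) hh]
  congr 1
  norm_num [Real.rpow_neg hh.le]

theorem volume_epigraph {X : Set ℝ} (hX : MeasurableSet X) {h : ℝ → ℝ} (hh : Measurable h)
    (hpos : ∀ x ∈ X, 0 < h x) :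
    volume {u : ℍ | u.re ∈ X ∧ h u.re < u.im} = ∫⁻ x in X, ENNReal.ofReal (1 / h x) := by
  have himg : ((↑) : ℍ → ℂ) '' {u : ℍ | u.re ∈ X ∧ h u.re < u.im} =
      Complex.measurableEquivRealProd ⁻¹' {q : ℝ × ℝ | q.1 ∈ X ∧ h q.1 < q.2} := by
    ext z
    constructor
    · rintro ⟨u, hu, rfl⟩
      exact hu
    · intro hz
      exact ⟨⟨z, (hpos _ hz.1).trans hz.2⟩, hz, rfl⟩
  have hm : MeasurableSet {q : ℝ × ℝ | q.1 ∈ X ∧ h q.1 < q.2} :=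
    (measurable_fst hX).inter (measurableSet_lt (hh.comp measurable_fst) measurable_snd)
  have hf : Measurable fun q : ℝ × ℝ => (((1 / ‖q.2‖₊) ^ 2 : NNReal) : ENNReal) := by
    fun_prop
  classical
  rw [volume_eq_lintegral, himg]
  have := Complex.volume_preserving_equiv_real_prod.setLIntegral_comp_preimage hm hf
  refine Eq.trans this ?_
  rw [← lintegral_indicator hm, Measure.volume_eq_prod, lintegral_prod _
    ((hf.indicator hm).aemeasurable), ← lintegral_indicator hX]
  refine lintegral_congr fun x => ?_
  by_cases hx : x ∈ X
  · rw [Set.indicator_of_mem hx, ← lintegral_Ioi_one_div_sq (hpos x hx),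
      ← lintegral_indicator measurableSet_Ioi]
    refine lintegral_congr fun y => ?_
    simp [Set.indicator_apply, hx]
  · rw [Set.indicator_of_notMem hx]
    simp [hx]

/-- The function `x ↦ 2 * arctan ((x - x₁) / (y₁ + h x))` is a primitive of `1 / h`, where `h` is
the height of the half-circle with centre `c` through `(x₁, y₁)`. -/
theorem hasDerivAt_two_mul_arctan {c x₁ y₁ x : ℝ} (hy₁ : 0 < y₁)
    (hx : 0 < (x₁ - c) ^ 2 + y₁ ^ 2 - (x - c) ^ 2) :
    HasDerivAt (fun x => 2 * Real.arctan ((x - x₁) / (y₁ + √((x₁ - c) ^ 2 + y₁ ^ 2 - (x - c) ^ 2))))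
      (1 / √((x₁ - c) ^ 2 + y₁ ^ 2 - (x - c) ^ 2)) x := by
  have hs : HasDerivAt (fun x => (x₁ - c) ^ 2 + y₁ ^ 2 - (x - c) ^ 2) (-(2 * (x - c))) x := by
    have := (((hasDerivAt_id x).sub_const c).pow 2).const_sub ((x₁ - c) ^ 2 + y₁ ^ 2)
    simpa using this
  have hh := hs.sqrt hx.ne'
  have hsq := Real.sq_sqrt hx.le
  have hpos := Real.sqrt_pos.2 hx
  set H := √((x₁ - c) ^ 2 + y₁ ^ 2 - (x - c) ^ 2) with hH
  have hd := (((hasDerivAt_id x).sub_const x₁).div (hh.const_add y₁)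
    (by positivity)).arctan.const_mul 2
  refine hd.congr_deriv ?_
  simp only [id, Pi.div_apply, ← hH]
  have hne : y₁ + H ≠ 0 := by positivity
  have hne2 : (y₁ + H) ^ 2 + (x - x₁) ^ 2 ≠ 0 := by positivity
  field_simp
  linear_combination (1 : ℝ) * hsq

theorem volume_above_circle {c : ℝ} {z w : ℍ} (hzw : z.re < w.re)
    (hc : (z.re - c) ^ 2 + z.im ^ 2 = (w.re - c) ^ 2 + w.im ^ 2) :
    volume {u : ℍ | u.re ∈ Set.Ico z.re w.re ∧
      (z.re - c) ^ 2 + z.im ^ 2 < (u.re - c) ^ 2 + u.im ^ 2} =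
      ENNReal.ofReal (2 * Real.arctan ((w.re - z.re) / (z.im + w.im))) := by
  have hz := z.im_pos
  have hw := w.im_pos
  have hpos : ∀ x ∈ Set.Icc z.re w.re, 0 < (z.re - c) ^ 2 + z.im ^ 2 - (x - c) ^ 2 := by
    rintro x ⟨h1, h2⟩
    rcases le_total c x with h3 | h3
    · nlinarith
    · nlinarith
  have hset : {u : ℍ | u.re ∈ Set.Ico z.re w.re ∧
      (z.re - c) ^ 2 + z.im ^ 2 < (u.re - c) ^ 2 + u.im ^ 2} =
      {u : ℍ | u.re ∈ Set.Ico z.re w.re ∧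
        √((z.re - c) ^ 2 + z.im ^ 2 - (u.re - c) ^ 2) < u.im} := by
    ext u
    simp only [Set.mem_ofPred_eq]
    rw [Real.sqrt_lt' u.im_pos, sub_lt_iff_lt_add']
  rw [hset, volume_epigraph measurableSet_Ico (by fun_prop) fun x hx =>
    Real.sqrt_pos.2 (hpos x (Set.Ico_subset_Icc_self hx)), restrict_Ico_eq_restrict_Ioc]
  have hcont : ContinuousOn (fun x => 1 / √((z.re - c) ^ 2 + z.im ^ 2 - (x - c) ^ 2))
      (Set.uIcc z.re w.re) := by
    rw [Set.uIcc_of_le hzw.le]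
    refine continuousOn_const.div (by fun_prop) fun x hx => (Real.sqrt_pos.2 (hpos x hx)).ne'
  have hint := hcont.intervalIntegrable (μ := volume)
  rw [← ofReal_integral_eq_lintegral_ofReal
    ((intervalIntegrable_iff_integrableOn_Ioc_of_le hzw.le).1 hint)
    (Filter.Eventually.of_forall fun x => by positivity),
    ← intervalIntegral.integral_of_le hzw.le,
    intervalIntegral.integral_eq_sub_of_hasDerivAt (fun x hx => hasDerivAt_two_mul_arctan hz
      (hpos x (by rwa [Set.uIcc_of_le hzw.le] at hx))) hint]
  have : (z.re - c) ^ 2 + z.im ^ 2 - (w.re - c) ^ 2 = w.im ^ 2 := by linarith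
  rw [this, Real.sqrt_sq hw.le]
  simp

/-- The set of points strictly above some point of the geodesic segment from `z` to `w`. -/
def shadow (z w : ℍ) : Set ℍ :=
  {u | ∃ v ∈ geodesicSegment z w, v.re = u.re ∧ v.im < u.im}

theorem volume_re_eq_zero (x : ℝ) : volume {u : ℍ | u.re = x} = 0 := by
  rw [volume_eq_lintegral]
  refine setLIntegral_measure_zero _ _ (measure_mono_null (t := {z : ℂ | z.re = x}) ?_ ?_)
  · rintro _ ⟨u, hu, rfl⟩
    exact hu
  · exact Complex.volume_preserving_equiv_real_prod.measure_preimage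
      ((measurable_fst (measurableSet_singleton x)).nullMeasurableSet) |>.trans (by
      change volume ((Prod.fst : ℝ × ℝ → ℝ) ⁻¹' {x}) = 0
      rw [← Set.prod_univ, Measure.volume_eq_prod, Measure.prod_prod]
      simp)

theorem volume_shadow_le (z w : ℍ) :
    volume (shadow z w) ≤ ENNReal.ofReal (2 * Real.arctan (|w.re - z.re| / (z.im + w.im))) := by
  wlog hzw : z.re ≤ w.re generalizing z w
  · have := this w z (le_of_not_ge hzw)
    rwa [abs_sub_comm, add_comm w.im, shadow, geodesicSegment_comm] at this
  rcases hzw.eq_or_lt with h | h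
  · refine le_trans (le_of_eq ?_) zero_le
    refine measure_mono_null ?_ (volume_re_eq_zero z.re)
    rintro u ⟨v, hv, hvu, -⟩
    exact hvu.symm.trans (re_eq_of_mem_geodesicSegment h hv)
  · rw [abs_of_pos (sub_pos.2 h), ← volume_above_circle h (geodesicCenter_spec h.ne)]
    -- the half-open interval in `volume_above_circle` misses only a vertical line
    have hsub : shadow z w ⊆ {u : ℍ | u.re ∈ Set.Ico z.re w.re ∧
        (z.re - geodesicCenter z w) ^ 2 + z.im ^ 2 <
          (u.re - geodesicCenter z w) ^ 2 + u.im ^ 2} ∪ {u : ℍ | u.re = w.re} := by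
      rintro u ⟨v, hv, hvu, him⟩
      have h1 := mem_geodesicSegment_of_lt h hv
      have h2 := mem_circle_of_mem_geodesicSegment h.ne hv
      rw [hvu] at h1 h2
      rcases h1.2.eq_or_lt with h3 | h3
      · exact Or.inr h3
      · refine Or.inl ⟨⟨h1.1, h3⟩, ?_⟩
        have := v.im_pos
        nlinarith
    refine (measure_mono hsub).trans ((measure_union_le _ _).trans ?_)
    rw [volume_re_eq_zero, add_zero]

end UpperHalfPlane

/-! ### Fundamental domains of the cylinder -/

namespace UpperHalfPlane

theorem measurable_re : Measurable (UpperHalfPlane.re) :=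
  Complex.measurable_re.comp measurable_coe

instance : ContinuousConstVAdd ℝ ℍ :=
  ⟨fun a => (isometry_real_vadd a).continuous⟩

instance : VAddInvariantMeasure ℝ ℍ volume := by
  refine ⟨fun a s _ => ?_⟩
  let g : GL (Fin 2) ℝ := Matrix.GeneralLinearGroup.mkOfDetNeZero !![1, a; 0, 1] (by simp)
  have hg : ∀ z : ℍ, g • z = a +ᵥ z := by
    intro z
    ext
    rw [coe_smul_of_det_pos (by simp [g, Matrix.GeneralLinearGroup.mkOfDetNeZero])]
    simp [g, num, denom, Matrix.GeneralLinearGroup.mkOfDetNeZero, add_comm]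
  simp_rw [← hg]
  exact measure_preimage_smul volume g s

/-- The vertical strips of width `1` are fundamental domains of the cylinder. -/
theorem isAddFundamentalDomain_strip (x : ℝ) :
    IsAddFundamentalDomain (AddSubgroup.zmultiples (1 : ℝ))
      {z : ℍ | x ≤ z.re ∧ z.re < x + 1} volume := by
  refine IsAddFundamentalDomain.mk' ?_ fun z => ?_
  · exact (measurable_re measurableSet_Ico).nullMeasurableSet
  · obtain ⟨m, hm, hu⟩ := existsUnique_add_zsmul_mem_Ico one_pos z.re x
    refine ⟨⟨m • 1, m, rfl⟩, ?_, ?_⟩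
    · change x ≤ ((m • (1 : ℝ)) +ᵥ z).re ∧ ((m • (1 : ℝ)) +ᵥ z).re < x + 1
      rw [vadd_re, add_comm]
      exact hm
    · rintro ⟨_, n, rfl⟩ hn
      have hn' : x ≤ ((n • (1 : ℝ)) +ᵥ z).re ∧ ((n • (1 : ℝ)) +ᵥ z).re < x + 1 := hn
      rw [vadd_re, add_comm] at hn'
      refine Subtype.ext ?_
      change n • (1 : ℝ) = m • (1 : ℝ)
      rw [hu n hn']

theorem geodesicSegment_vadd {z w u : ℍ} (a : ℝ) (hu : u ∈ geodesicSegment z w) :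
    a +ᵥ u ∈ geodesicSegment (a +ᵥ z) (a +ᵥ w) := by
  have h := fun z w => (isometry_real_vadd a).dist_eq z w
  change dist _ _ + dist _ _ = dist _ _
  rw [h, h, h]
  exact hu

theorem shadow_vadd {z w u : ℍ} (a : ℝ) (hu : u ∈ shadow z w) :
    a +ᵥ u ∈ shadow (a +ᵥ z) (a +ᵥ w) := by
  obtain ⟨v, hv, h1, h2⟩ := hu
  exact ⟨a +ᵥ v, geodesicSegment_vadd a hv, by simp [h1], by simpa using h2⟩

/-- On a vertical line that meets a set and its complement there is a frontier point in between. -/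
theorem exists_mem_frontier_of_re_eq {s : Set ℍ} {z w : ℍ} (hz : z ∈ s) (hw : w ∉ s)
    (hre : z.re = w.re) : ∃ u ∈ frontier s, u.re = z.re ∧ u.im ∈ Set.uIcc z.im w.im := by
  let t : Set ℍ := {u | u.re = z.re ∧ u.im ∈ Set.uIcc z.im w.im}
  have ht : IsPreconnected t := by
    rw [← isOpenEmbedding_coe.toIsEmbedding.toIsInducing.isPreconnected_image]
    have : ((↑) : ℍ → ℂ) '' t = (fun y : ℝ => (⟨z.re, y⟩ : ℂ)) '' Set.uIcc z.im w.im := by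
      ext u
      constructor
      · rintro ⟨v, ⟨h1, h2⟩, rfl⟩
        exact ⟨v.im, h2, Complex.ext h1.symm rfl⟩
      · rintro ⟨y, hy, rfl⟩
        exact ⟨⟨⟨z.re, y⟩, (lt_min z.im_pos w.im_pos).trans_le hy.1⟩, ⟨rfl, hy⟩, rfl⟩
    rw [this]
    refine isPreconnected_uIcc.image _ (Continuous.continuousOn ?_)
    have : (fun y : ℝ => (⟨z.re, y⟩ : ℂ)) = fun y : ℝ => (z.re : ℂ) + y * Complex.I := by
      ext y
      apply Complex.ext <;> simp
    rw [this]
    fun_prop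
  by_contra! hno
  have hcover : t ⊆ interior s ∪ interior sᶜ := fun u hu => by
    have huf : u ∉ frontier s := fun huf => hno u huf hu.1 hu.2
    rw [interior_compl, Set.mem_union, Set.mem_compl_iff]
    by_contra! h
    exact huf ⟨h.2, h.1⟩
  have hzt : z ∈ t := ⟨rfl, Set.left_mem_uIcc⟩
  have hwt : w ∈ t := ⟨hre.symm, Set.right_mem_uIcc⟩
  obtain ⟨u, -, hu1, hu2⟩ := ht _ _ isOpen_interior isOpen_interior hcover
    ⟨z, hzt, (hcover hzt).resolve_right fun h => interior_subset h hz⟩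
    ⟨w, hwt, (hcover hwt).resolve_left fun h => hw (interior_subset h)⟩
  exact interior_subset hu2 (interior_subset hu1)

end UpperHalfPlane

/-! ### Area of a polygonal cusp -/

/-- The largest possible area above a geodesic segment of length `l`. -/
noncomputable def sideArea (l : ℝ) : ℝ :=
  2 * Real.arctan (Real.sinh (l / 2))

theorem hasDerivAt_sideArea (l : ℝ) : HasDerivAt sideArea (1 / Real.cosh (l / 2)) l := by
  have h := (((hasDerivAt_id l).div_const 2).sinh.arctan).const_mul 2
  refine h.congr_deriv ?_
  have := Real.cosh_pos (l / 2)
  simp only [id]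
  rw [add_comm, ← Real.cosh_sq]
  field_simp

theorem strictConcaveOn_sideArea : StrictConcaveOn ℝ (Set.Ici 0) sideArea := by
  have hd : deriv sideArea = fun l => 1 / Real.cosh (l / 2) :=
    funext fun l => (hasDerivAt_sideArea l).deriv
  refine StrictAntiOn.strictConcaveOn_of_deriv (convex_Ici 0)
    (fun l _ => (hasDerivAt_sideArea l).continuousAt.continuousWithinAt) ?_
  rw [interior_Ici, hd]
  intro a ha b hb hab
  have ha' : 0 < a := ha
  have : Real.cosh (a / 2) < Real.cosh (b / 2) := by
    rw [Real.cosh_lt_cosh, abs_of_pos (by linarith), abs_of_pos (by linarith)]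
    linarith
  exact one_div_lt_one_div_of_lt (Real.cosh_pos _) this

/-- Among the segments of a given length, the area above the segment is largest if and only if the
endpoints have the same height. The statement is in terms of the tangent of half the area. -/
theorem abs_div_add_sq_le (z w : ℍ) :
    (|w.re - z.re| / (z.im + w.im)) ^ 2 ≤ Real.sinh (dist z w / 2) ^ 2 ∧
      ((|w.re - z.re| / (z.im + w.im)) ^ 2 = Real.sinh (dist z w / 2) ^ 2 → z.im = w.im) := by
  have hz := z.im_pos
  have hw := w.im_pos
  have key : Real.sinh (dist z w / 2) ^ 2 - (|w.re - z.re| / (z.im + w.im)) ^ 2 =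
      (z.im - w.im) ^ 2 * ((w.re - z.re) ^ 2 + (z.im + w.im) ^ 2) /
        (4 * z.im * w.im * (z.im + w.im) ^ 2) := by
    rw [sinh_half_dist_sq, div_pow, sq_abs]
    field_simp
    ring
  constructor
  · rw [← sub_nonneg, key]
    positivity
  · intro h
    rw [h, sub_self, eq_comm, div_eq_zero_iff, mul_eq_zero] at key
    rcases key with (key | key) | key
    · exact sub_eq_zero.1 (pow_eq_zero_iff two_ne_zero |>.1 key)
    · exact absurd key (by positivity)
    · exact absurd key (by positivity)

theorem two_mul_arctan_le_sideArea (z w : ℍ) :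
    2 * Real.arctan (|w.re - z.re| / (z.im + w.im)) ≤ sideArea (dist z w) := by
  have hz := z.im_pos
  have hw := w.im_pos
  have hs : 0 ≤ Real.sinh (dist z w / 2) := Real.sinh_nonneg_iff.2 (by positivity)
  exact mul_le_mul_of_nonneg_left (Real.arctan_strictMono.monotone
    ((sq_le_sq₀ (by positivity) hs).1 (abs_div_add_sq_le z w).1)) zero_le_two

theorem im_eq_of_two_mul_arctan_eq_sideArea {z w : ℍ}
    (h : 2 * Real.arctan (|w.re - z.re| / (z.im + w.im)) = sideArea (dist z w)) :
    z.im = w.im := by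
  refine (abs_div_add_sq_le z w).2 ?_
  rw [Real.arctan_injective (mul_left_cancel₀ two_ne_zero h)]

namespace PolygonalCusp

variable {p : ℕ}

theorem vertex_add_mul (P : PolygonalCusp p) (i k : ℤ) :
    P.vertex (i + k * p) = (k : ℝ) +ᵥ P.vertex i := by
  induction k using Int.induction_on with
  | zero => simp
  | succ k ih =>
    rw [show i + ((k : ℤ) + 1) * p = i + k * p + p by ring, P.vertex_add, ih, vadd_vadd]
    push_cast
    rw [add_comm]
  | pred k ih =>
    have h := P.vertex_add (i + (-(k : ℤ) - 1) * p)
    rw [show i + (-(k : ℤ) - 1) * p + p = i + -(k : ℤ) * p by ring, ih] at h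
    rw [← vadd_left_cancel_iff (1 : ℝ), ← h, vadd_vadd]
    push_cast
    congr 1
    ring

/-- Below every point of the region there is a side, because the region stays away from the real
axis. -/
theorem region_subset_iUnion_shadow (P : PolygonalCusp p) :
    P.region ⊆ ⋃ i : ℤ, shadow (P.vertex i) (P.vertex (i + 1)) := by
  intro z hz
  obtain ⟨ε, hε, hP⟩ := P.im_ge_of_mem_region
  have hε2 : 0 < (⟨z.re, ε / 2⟩ : ℂ).im := half_pos hε
  have hw : (⟨⟨z.re, ε / 2⟩, hε2⟩ : ℍ) ∉ P.region := by
    intro h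
    have := hP _ h
    change ε ≤ ε / 2 at this
    linarith
  obtain ⟨u, hu, hre, him⟩ := exists_mem_frontier_of_re_eq hz hw rfl
  have hne : u.im ≠ z.im := by
    intro h
    rw [ext_re_im hre h, P.isOpen_region.frontier_eq] at hu
    exact hu.2 hz
  have hle : (ε / 2 : ℝ) ≤ z.im := by linarith [hP z hz]
  change u.im ∈ Set.uIcc z.im (ε / 2) at him
  rw [Set.uIcc_of_ge hle] at him
  rw [P.frontier_region, Set.mem_iUnion] at hu
  obtain ⟨i, hi⟩ := hu
  exact Set.mem_iUnion.2 ⟨i, u, hi, hre, lt_of_le_of_ne him.2 hne⟩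

open scoped Pointwise in
/-- The area is at most the sum of the areas above the sides of one period. -/
theorem area_le_sum (P : PolygonalCusp p) (hp : 1 ≤ p) :
    P.area ≤ ∑ i ∈ Finset.range p, ENNReal.ofReal (2 * Real.arctan
      (|(P.vertex (i + 1)).re - (P.vertex i).re| / ((P.vertex i).im + (P.vertex (i + 1)).im))) := by
  have hp' : (p : ℤ) ≠ 0 := by exact_mod_cast (by omega : p ≠ 0)
  let S : ℤ → Set ℍ := fun i => shadow (P.vertex i) (P.vertex (i + 1))
  have hF := isAddFundamentalDomain_strip 0
  rw [zero_add] at hF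
  have hsub : P.region ∩ {z : ℍ | 0 ≤ z.re ∧ z.re < 1} ⊆
      ⋃ i ∈ Finset.range p, ⋃ g : AddSubgroup.zmultiples (1 : ℝ),
        (g +ᵥ S i) ∩ {z : ℍ | 0 ≤ z.re ∧ z.re < 1} := by
    rintro z ⟨hz, hz1⟩
    obtain ⟨i, hi⟩ := Set.mem_iUnion.1 (P.region_subset_iUnion_shadow hz)
    have hmod := Int.emod_nonneg i hp'
    have hlt := Int.emod_lt_of_pos i (show (0 : ℤ) < p by omega)
    have hj : ((i % p).toNat : ℤ) = i % p := Int.toNat_of_nonneg hmod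
    have hmem : (-((i / p : ℤ) : ℝ)) +ᵥ z ∈ S (i % p) := by
      have hi2 : i = i % p + i / p * p := (Int.emod_add_ediv_mul i p).symm
      generalize i / (p : ℤ) = k at hi2 ⊢
      generalize i % (p : ℤ) = r at hi2 ⊢
      subst hi2
      have := shadow_vadd (-(k : ℝ)) hi
      rwa [show r + k * p + 1 = r + 1 + k * p by ring, P.vertex_add_mul,
        P.vertex_add_mul, neg_vadd_vadd, neg_vadd_vadd] at this
    refine Set.mem_iUnion₂.2 ⟨(i % p).toNat, Finset.mem_range.2 (by omega), Set.mem_iUnion.2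
      ⟨⟨((i / p : ℤ) : ℝ), i / p, by simp⟩, ?_, hz1⟩⟩
    rw [hj]
    refine ⟨_, hmem, ?_⟩
    exact vadd_neg_vadd _ _
  refine (measure_mono hsub).trans ((measure_biUnion_finset_le _ _).trans ?_)
  refine Finset.sum_le_sum fun i _ => (measure_iUnion_le _).trans ?_
  rw [← hF.measure_eq_tsum]
  exact volume_shadow_le _ _

/-- Successive vertices are translates of each other by the same real number, necessarily `1 / p`:
the form that regular polygonal cusps take. -/
def IsTranslational (P : PolygonalCusp p) : Prop :=
  ∀ i : ℤ, P.vertex (i + 1) = (1 / p : ℝ) +ᵥ P.vertex i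

namespace IsTranslational

variable {P : PolygonalCusp p}

theorem re_vertex_add_one (h : P.IsTranslational) (i : ℤ) :
    (P.vertex (i + 1)).re = (P.vertex i).re + 1 / p := by
  rw [h i, vadd_re, add_comm]

theorem re_vertex (h : P.IsTranslational) (i : ℤ) :
    (P.vertex i).re = (P.vertex 0).re + i / p := by
  induction i using Int.induction_on with
  | zero => simp
  | succ k ih =>
    rw [h.re_vertex_add_one, ih]
    push_cast
    ring
  | pred k ih =>
    have := h.re_vertex_add_one (-(k : ℤ) - 1)
    rw [sub_add_cancel, ih] at this
    push_cast at this ⊢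
    linear_combination -this

theorem im_vertex (h : P.IsTranslational) (i : ℤ) : (P.vertex i).im = (P.vertex 0).im := by
  induction i using Int.induction_on with
  | zero => rfl
  | succ k ih => rw [h k, vadd_im, ih]
  | pred k ih =>
    have := h (-(k : ℤ) - 1)
    rw [sub_add_cancel] at this
    rw [← ih, this, vadd_im]

theorem sinh_half_sideLength (h : P.IsTranslational) (i : ℤ) :
    Real.sinh (P.sideLength i / 2) = 1 / p / (2 * (P.vertex 0).im) := by
  have hy := (P.vertex 0).im_pos
  have hs : 0 ≤ Real.sinh (P.sideLength i / 2) :=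
    Real.sinh_nonneg_iff.2 (div_nonneg dist_nonneg zero_le_two)
  rw [← sq_eq_sq₀ hs (by positivity), sideLength, sinh_half_dist_sq, h.re_vertex_add_one,
    h.im_vertex, h.im_vertex (i + 1), div_pow]
  ring

theorem sideLength_eq (h : P.IsTranslational) (i j : ℤ) : P.sideLength i = P.sideLength j := by
  have := (h.sinh_half_sideLength i).trans (h.sinh_half_sideLength j).symm
  have := Real.sinh_injective this
  linarith

theorem sideLength_eq_perimeter_div (h : P.IsTranslational) (hp : 1 ≤ p) (i : ℤ) :
    P.sideLength i = P.perimeter / p := by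
  have hp' : (p : ℝ) ≠ 0 := by exact_mod_cast (by omega : p ≠ 0)
  rw [perimeter, Finset.sum_congr rfl fun (j : ℕ) _ => h.sideLength_eq j i]
  simp [hp']

theorem geodesicCenter_vertex (h : P.IsTranslational) (hp : 1 ≤ p) (i : ℤ) :
    geodesicCenter (P.vertex i) (P.vertex (i + 1)) = (P.vertex i).re + 1 / p / 2 := by
  have hp' : (p : ℝ) ≠ 0 := by exact_mod_cast (by omega : p ≠ 0)
  rw [geodesicCenter, h.re_vertex_add_one, h.im_vertex (i + 1), h.im_vertex i]
  field_simp
  ring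

/-- Points above the boundary curve belong to the region, since otherwise a frontier point would
lie above them. -/
theorem mem_region (h : P.IsTranslational) (hp : 1 ≤ p) {i : ℤ} {z : ℍ}
    (hz : z.re ∈ Set.Ico (P.vertex i).re (P.vertex (i + 1)).re)
    (hc : ((P.vertex i).re - geodesicCenter (P.vertex i) (P.vertex (i + 1))) ^ 2 +
        (P.vertex i).im ^ 2 <
      (z.re - geodesicCenter (P.vertex i) (P.vertex (i + 1))) ^ 2 + z.im ^ 2) :
    z ∈ P.region := by
  have hp' : (0 : ℝ) < p := by exact_mod_cast hp
  by_contra hzr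
  obtain ⟨c, hcusp⟩ := P.mem_region_of_lt_im
  have him : z.im < max c z.im + 1 := by linarith [le_max_right c z.im]
  have hw0 : 0 < (⟨z.re, max c z.im + 1⟩ : ℂ).im := z.im_pos.trans him
  have hw : (⟨⟨z.re, max c z.im + 1⟩, hw0⟩ : ℍ) ∈ P.region :=
    hcusp _ (by
      change c < max c z.im + 1
      linarith [le_max_left c z.im])
  obtain ⟨u, hu, hre, huim⟩ := exists_mem_frontier_of_re_eq hw hzr rfl
  change u.re = z.re at hre
  change u.im ∈ Set.uIcc (max c z.im + 1) z.im at huim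
  rw [Set.uIcc_of_ge him.le] at huim
  have hzu := huim.1
  rw [P.frontier_region, Set.mem_iUnion] at hu
  obtain ⟨j, hj⟩ := hu
  have hlt : ∀ k : ℤ, (P.vertex k).re < (P.vertex (k + 1)).re := fun k => by
    rw [h.re_vertex_add_one]
    have : 0 < 1 / (p : ℝ) := by positivity
    linarith
  have h1 := mem_geodesicSegment_of_lt (hlt j) hj
  have h2 := mem_circle_of_mem_geodesicSegment (hlt j).ne hj
  have hy := (P.vertex 0).im_pos
  have hz0 := z.im_pos
  rw [h.geodesicCenter_vertex hp, h.im_vertex] at hc h2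
  rw [hre] at h1 h2
  obtain ⟨hz1, hz2⟩ := hz
  rw [h.re_vertex_add_one] at h1 hz2
  have e1 := h.re_vertex i
  have e2 := h.re_vertex j
  have hij : j ≤ i := by
    have : ((j : ℝ) / p) < ((i + 1 : ℝ) / p) := by
      rw [add_div]
      linarith
    rw [div_lt_div_iff_of_pos_right hp'] at this
    have : j < i + 1 := by exact_mod_cast this
    omega
  have hji : i ≤ j + 1 := by
    have : ((i : ℝ) / p) ≤ ((j + 1 : ℝ) / p) := by
      rw [add_div]
      linarith
    rw [div_le_div_iff_of_pos_right hp'] at this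
    exact_mod_cast this
  obtain rfl | rfl : j = i ∨ i = j + 1 := by omega
  · nlinarith
  · -- then `u` is above the common endpoint of two consecutive sides
    rw [h.re_vertex_add_one] at hz1 hc
    have : z.re = (P.vertex j).re + 1 / p := le_antisymm h1.2 hz1
    rw [this] at hc h2
    nlinarith

theorem area_eq (h : P.IsTranslational) (hp : 1 ≤ p) :
    P.area = ENNReal.ofReal (p * sideArea (P.perimeter / p)) := by
  have hp' : (0 : ℝ) < p := by exact_mod_cast hp
  have hlt : ∀ k : ℤ, (P.vertex k).re < (P.vertex (k + 1)).re := fun k => by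
    rw [h.re_vertex_add_one]
    have : 0 < 1 / (p : ℝ) := by positivity
    linarith
  have hside : ∀ i : ℤ, 2 * Real.arctan (((P.vertex (i + 1)).re - (P.vertex i).re) /
      ((P.vertex i).im + (P.vertex (i + 1)).im)) = sideArea (P.perimeter / p) := by
    intro i
    rw [← h.sideLength_eq_perimeter_div hp i, sideArea, h.sinh_half_sideLength,
      h.re_vertex_add_one, h.im_vertex, h.im_vertex (i + 1), add_sub_cancel_left,
      two_mul (P.vertex 0).im]
  have hsum : ENNReal.ofReal (p * sideArea (P.perimeter / p)) =
      ∑ i ∈ Finset.range p, ENNReal.ofReal (sideArea (P.perimeter / p)) := by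
    rw [Finset.sum_const, Finset.card_range, nsmul_eq_mul, ENNReal.ofReal_mul hp'.le,
      ENNReal.ofReal_natCast]
  rw [hsum]
  refine le_antisymm ?_ ?_
  · refine (P.area_le_sum hp).trans (le_of_eq (Finset.sum_congr rfl fun i _ => ?_))
    rw [abs_of_pos (sub_pos.2 (hlt i)), hside]
  · have hinv : ∀ g : AddSubgroup.zmultiples (1 : ℝ),
        (fun z : ℍ => g +ᵥ z) ⁻¹' P.region = P.region := by
      rintro ⟨_, n, rfl⟩
      ext z
      change ((n • (1 : ℝ)) +ᵥ z) ∈ P.region ↔ _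
      rw [zsmul_one]
      induction n using Int.induction_on with
      | zero => simp
      | succ k ih =>
        rw [← ih, ← P.vadd_mem_region (((k : ℤ) : ℝ) +ᵥ z), vadd_vadd]
        push_cast
        rw [add_comm]
      | pred k ih =>
        rw [← ih, ← P.vadd_mem_region, vadd_vadd]
        push_cast
        rw [add_sub_cancel]
    have hF0 := isAddFundamentalDomain_strip 0
    rw [zero_add] at hF0
    rw [area, hF0.measure_set_eq (isAddFundamentalDomain_strip (P.vertex 0).re)
      P.isOpen_region.measurableSet hinv]
    let S : ℤ → Set ℍ := fun i => {u : ℍ | u.re ∈ Set.Ico (P.vertex i).re (P.vertex (i + 1)).re ∧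
      ((P.vertex i).re - geodesicCenter (P.vertex i) (P.vertex (i + 1))) ^ 2 +
        (P.vertex i).im ^ 2 <
      (u.re - geodesicCenter (P.vertex i) (P.vertex (i + 1))) ^ 2 + u.im ^ 2}
    have hS : ∀ i : ℤ, volume (S i) = ENNReal.ofReal (sideArea (P.perimeter / p)) := by
      intro i
      rw [← hside i]
      exact volume_above_circle (hlt i) (geodesicCenter_spec (hlt i).ne)
    have hSm : ∀ i : ℤ, MeasurableSet (S i) := by
      intro i
      have h1 := measurable_re
      have h2 : Measurable (UpperHalfPlane.im) := Complex.measurable_im.comp measurable_coe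
      exact (h1 measurableSet_Ico).inter (measurableSet_lt measurable_const
        (((h1.sub_const _).pow_const 2).add (h2.pow_const 2)))
    have hmono : StrictMono fun i : ℤ => (P.vertex i).re := strictMono_int_of_lt_succ hlt
    have hdisj : Pairwise (Function.onFun Disjoint S) := by
      have key : ∀ i j : ℤ, i < j → Disjoint (S i) (S j) := by
        intro i j hij
        rw [Set.disjoint_left]
        rintro u ⟨hu, -⟩ ⟨hu', -⟩
        have := hmono.monotone (show i + 1 ≤ j by omega)
        exact absurd (hu.2.trans_le this) (not_lt.2 hu'.1)
      intro i j hij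
      rcases lt_or_gt_of_ne hij with h' | h'
      · exact key i j h'
      · exact (key j i h').symm
    rw [← Finset.sum_congr rfl fun (i : ℕ) _ => hS i, ← measure_biUnion_finset (f := fun i : ℕ => S i)
      (fun i _ j _ hij => hdisj (by exact_mod_cast hij)) fun i _ => hSm i]
    refine measure_mono (Set.iUnion₂_subset fun i hi => ?_)
    rintro u ⟨hu, hc⟩
    refine ⟨h.mem_region hp hu hc, ?_, ?_⟩
    · exact (hmono.monotone (Int.natCast_nonneg i)).trans hu.1
    · have h1 : ((i : ℤ) + 1) ≤ (p : ℤ) := by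
        have := Finset.mem_range.1 hi
        omega
      have h2 := hmono.monotone h1
      have h3 := P.vertex_add 0
      rw [zero_add] at h3
      have h4 : (P.vertex p).re = (P.vertex 0).re + 1 := by rw [h3, vadd_re, add_comm]
      exact hu.2.trans_le (h2.trans h4.le)

end IsTranslational

end PolygonalCusp

/-! ### Regular cusps have equally spaced vertices on a horocycle -/

namespace UpperHalfPlane

open ComplexConjugate

theorem coe_sub_conj_ne_zero (z w : ℍ) : (w : ℂ) - conj (z : ℂ) ≠ 0 := by
  intro h
  have := congrArg Complex.im h
  simp only [Complex.sub_im, Complex.conj_im, Complex.zero_im, coe_im] at this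
  linarith [z.im_pos, w.im_pos]

theorem norm_geodesicDirection (z w : ℍ) :
    ‖geodesicDirection z w‖ = Real.tanh (dist z w / 2) := by
  rw [geodesicDirection, norm_mul, Complex.norm_I, one_mul, norm_div, dist_comm, tanh_half_dist,
    dist_eq_norm, dist_eq_norm]

theorem geodesicDirection_ne_zero {z w : ℍ} (h : z ≠ w) : geodesicDirection z w ≠ 0 := by
  have h1 : (w : ℂ) - z ≠ 0 := sub_ne_zero.2 fun h' => h (UpperHalfPlane.ext h').symm
  exact mul_ne_zero Complex.I_ne_zero (div_ne_zero h1 (coe_sub_conj_ne_zero z w))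

/-- If `z`, `w` and `w`, `u` are at the same distance, then a real Möbius transformation maps `z` to
`w` and `w` to `u`. It is the transformation that corresponds, in the unit discs centred at `z` and
at `w`, to the rotation by the unit complex number
`s ^ 2 = geodesicDirection w u / geodesicDirection z w`. -/
theorem exists_moebius_of_dist_eq {z w u : ℍ} (hzw : z ≠ w) (h : dist z w = dist w u) :
    ∃ a b c d : ℝ, a * d - b * c ≠ 0 ∧ ((c : ℂ) * z + d) * w = a * z + b ∧
      ((c : ℂ) * w + d) * u = a * w + b := by
  have hd := geodesicDirection_ne_zero hzw
  obtain ⟨s, hs⟩ := IsAlgClosed.exists_pow_nat_eq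
    (geodesicDirection w u / geodesicDirection z w) two_pos
  have hnorm : ‖s‖ = 1 := by
    have h1 := congrArg norm hs
    rw [norm_pow, norm_div, norm_geodesicDirection, norm_geodesicDirection, ← h,
      ← norm_geodesicDirection, div_self (norm_ne_zero_iff.2 hd)] at h1
    exact (pow_eq_one_iff_of_nonneg (norm_nonneg _) two_ne_zero).1 h1
  have hss : s * conj s = 1 := by
    rw [Complex.mul_conj, Complex.normSq_eq_norm_sq, hnorm]
    simp
  have key : s * ((w : ℂ) - z) * (u - conj (w : ℂ)) =
      conj s * (w - conj (z : ℂ)) * (u - w) := by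
    rw [eq_div_iff hd, geodesicDirection, geodesicDirection] at hs
    have h1 := coe_sub_conj_ne_zero z w
    have h2 := coe_sub_conj_ne_zero w u
    have h3 : s ^ 2 * ((w : ℂ) - z) * (u - conj (w : ℂ)) = (w - conj (z : ℂ)) * (u - w) := by
      have := Complex.I_ne_zero
      field_simp at hs
      linear_combination hs
    linear_combination conj s * h3 -
      (s * ((w : ℂ) - z) * (u - conj (w : ℂ))) * hss
  refine ⟨(conj s * w).im, (s * z * conj (w : ℂ)).im, -s.im, (s * z).im, ?_, ?_, ?_⟩
  · have hns : s.re * s.re + s.im * s.im = 1 := by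
      have := congrArg Complex.re hss
      simpa using this
    have : (conj s * (w : ℂ)).im * (s * z).im - (s * z * conj (w : ℂ)).im * -s.im =
        z.im * w.im := by
      simp only [Complex.mul_im, Complex.mul_re, Complex.conj_re, Complex.conj_im, coe_re, coe_im]
      linear_combination (z.im * w.im) * hns
    rw [this]
    exact (mul_pos z.im_pos w.im_pos).ne'
  · push_cast
    simp only [Complex.im_eq_sub_conj, map_mul, Complex.conj_conj]
    have := Complex.I_ne_zero
    field_simp
    ring
  · push_cast
    simp only [Complex.im_eq_sub_conj, map_mul, Complex.conj_conj]
    have := Complex.I_ne_zero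
    field_simp
    linear_combination -key

theorem denom_coe_ne_zero {a b c d : ℝ} (hdet : a * d - b * c ≠ 0) (z : ℍ) :
    (c : ℂ) * z + d ≠ 0 := by
  intro h
  have h1 := congrArg Complex.im h
  have h2 := congrArg Complex.re h
  simp only [Complex.add_im, Complex.mul_im, Complex.ofReal_re, Complex.ofReal_im, coe_im,
    zero_mul, add_zero, Complex.zero_im, mul_eq_zero, z.im_ne_zero, or_false] at h1
  subst h1
  simp only [Complex.ofReal_zero, zero_mul, zero_add, Complex.ofReal_re, Complex.zero_re] at h2
  subst h2
  simp at hdet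

/-- A real Möbius transformation that maps `z` to `w` and `w` to `u` also maps `u` to `x`, if the
angle and the ratio of lengths are the same in the corners `z, w, u` and `w, u, x`. -/
theorem moebius_eq_of_geodesicDirection {a b c d : ℝ} (hdet : a * d - b * c ≠ 0) {z w u x : ℍ}
    {q : ℂ} (hq : q ≠ 0) (hzw : ((c : ℂ) * z + d) * w = a * z + b)
    (hwu : ((c : ℂ) * w + d) * u = a * w + b)
    (h1 : geodesicDirection w z = q * geodesicDirection w u)
    (h2 : geodesicDirection u w = q * geodesicDirection u x) :
    ((c : ℂ) * u + d) * x = a * u + b := by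
  have hw := denom_coe_ne_zero hdet w
  have hu := denom_coe_ne_zero hdet u
  have hz := denom_coe_ne_zero hdet z
  have hI := Complex.I_ne_zero
  have e1 := coe_sub_conj_ne_zero w z
  have e2 := coe_sub_conj_ne_zero w u
  have e3 := coe_sub_conj_ne_zero u w
  have e4 := coe_sub_conj_ne_zero u x
  have hdet' : (a : ℂ) * d - b * c ≠ 0 := by exact_mod_cast hdet
  have hwc : (c : ℂ) * conj (w : ℂ) + d ≠ 0 := by
    intro h
    apply hw
    have := congrArg conj h
    simpa using this
  have hwuc : ((c : ℂ) * conj (w : ℂ) + d) * conj (u : ℂ) = a * conj (w : ℂ) + b := by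
    have := congrArg conj hwu
    simpa using this
  rw [geodesicDirection, geodesicDirection] at h1 h2
  -- `y` is the image of `u`; the Cayley transforms at `w` and at `u` are intertwined up to a factor
  set y : ℂ := (a * u + b) / (c * u + d) with hy
  have hyu : ((c : ℂ) * u + d) * y = a * u + b := by
    rw [hy]
    field_simp
  have f1 : ((c : ℂ) * u + d) * (c * w + d) * (y - u) = (a * d - b * c) * (u - w) := by
    linear_combination ((c : ℂ) * w + d) * hyu - ((c : ℂ) * u + d) * hwu
  have f2 : ((c : ℂ) * u + d) * (c * conj (w : ℂ) + d) * (y - conj (u : ℂ)) =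
      (a * d - b * c) * (u - conj (w : ℂ)) := by
    linear_combination ((c : ℂ) * conj (w : ℂ) + d) * hyu - ((c : ℂ) * u + d) * hwuc
  have f3 : ((c : ℂ) * z + d) * (c * w + d) * (w - u) = (a * d - b * c) * (z - w) := by
    linear_combination ((c : ℂ) * w + d) * hzw - ((c : ℂ) * z + d) * hwu
  have f4 : ((c : ℂ) * z + d) * (c * conj (w : ℂ) + d) * (w - conj (u : ℂ)) =
      (a * d - b * c) * (z - conj (w : ℂ)) := by
    linear_combination ((c : ℂ) * conj (w : ℂ) + d) * hzw - ((c : ℂ) * z + d) * hwuc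
  have hyc : y - conj (u : ℂ) ≠ 0 := by
    intro h
    rw [h, mul_zero] at f2
    exact mul_ne_zero hdet' e2 f2.symm
  have g1 : ((u : ℂ) - w) / (u - conj (w : ℂ)) =
      (c * w + d) / (c * conj (w : ℂ) + d) * ((y - u) / (y - conj (u : ℂ))) := by
    rw [div_mul_div_comm, div_eq_div_iff e2 (mul_ne_zero hwc hyc)]
    refine mul_left_cancel₀ (mul_ne_zero hdet' hu) ?_
    linear_combination (-(((c : ℂ) * u + d) * (c * conj (w : ℂ) + d) * (y - conj (u : ℂ)))) * f1
      + (((c : ℂ) * u + d) * (c * w + d) * (y - u)) * f2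
  have g2 : ((z : ℂ) - w) / (z - conj (w : ℂ)) =
      (c * w + d) / (c * conj (w : ℂ) + d) * ((w - u) / (w - conj (u : ℂ))) := by
    rw [div_mul_div_comm, div_eq_div_iff e1 (mul_ne_zero hwc e3)]
    refine mul_left_cancel₀ (mul_ne_zero hdet' hz) ?_
    linear_combination (-(((c : ℂ) * z + d) * (c * conj (w : ℂ) + d) * (w - conj (u : ℂ)))) * f3
      + (((c : ℂ) * z + d) * (c * w + d) * (w - u)) * f4
  rw [g1, g2] at h1
  have g3 : ((w : ℂ) - u) / (w - conj (u : ℂ)) = q * ((y - u) / (y - conj (u : ℂ))) := by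
    refine mul_left_cancel₀ (mul_ne_zero hI (div_ne_zero hw hwc)) ?_
    linear_combination h1
  have g4 : (y - u) / (y - conj (u : ℂ)) = ((x : ℂ) - u) / (x - conj (u : ℂ)) := by
    refine mul_left_cancel₀ (mul_ne_zero hI hq) ?_
    linear_combination h2 - Complex.I * g3
  rw [div_eq_div_iff hyc e4] at g4
  have g5 : (y - x) * ((u : ℂ) - conj (u : ℂ)) = 0 := by linear_combination g4
  have : y = x := sub_eq_zero.1
    ((mul_eq_zero.1 g5).resolve_right (coe_sub_conj_ne_zero u u))
  rw [← this, hyu]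

end UpperHalfPlane

namespace PolygonalCusp

variable {p : ℕ}

/-- The quotient of directions whose argument defines the interior angle. -/
noncomputable def cornerRatio (P : PolygonalCusp p) (i : ℤ) : ℂ :=
  geodesicDirection (P.vertex i) (P.vertex (i - 1)) /
    geodesicDirection (P.vertex i) (P.vertex (i + 1))

theorem IsRegular.cornerRatio_eq {P : PolygonalCusp p} (h : P.IsRegular) (i j : ℤ) :
    P.cornerRatio i = P.cornerRatio j := by
  have hnorm : ∀ k, ‖P.cornerRatio k‖ = 1 := by
    intro k
    have hne := geodesicDirection_ne_zero (P.vertex_ne k)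
    have hlen := h.1 (k - 1) k
    rw [sideLength, sideLength, sub_add_cancel] at hlen
    rw [cornerRatio, norm_div, norm_geodesicDirection, dist_comm, hlen, ← norm_geodesicDirection,
      div_self (norm_ne_zero_iff.2 hne)]
  have hang := h.2 i j
  have hexp : ∀ k, P.cornerRatio k = Complex.exp (P.interiorAngle k * Complex.I) := by
    intro k
    rw [← Complex.norm_mul_exp_arg_mul_I (P.cornerRatio k), hnorm, Complex.ofReal_one, one_mul,
      interiorAngle, toIcoMod]
    push_cast
    rw [sub_mul, zsmul_eq_mul, mul_assoc, Complex.exp_periodic.sub_int_mul_eq]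
    rfl
  rw [hexp, hexp, hang]

/-- A real Möbius transformation maps every vertex of a regular cusp to the next one. It commutes
with `T` on the vertices, hence is a translation. -/
theorem IsRegular.isTranslational {P : PolygonalCusp p} (h : P.IsRegular) (hp : 1 ≤ p) :
    P.IsTranslational := by
  intro i
  have hp' : (p : ℂ) ≠ 0 := by exact_mod_cast (by omega : p ≠ 0)
  have hlen := h.1 i (i + 1)
  obtain ⟨a, b, c, d, hdet, h1, h2⟩ := exists_moebius_of_dist_eq (P.vertex_ne i) hlen
  have hne := geodesicDirection_ne_zero (P.vertex_ne i)
  have hq : P.cornerRatio i ≠ 0 := by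
    refine div_ne_zero (geodesicDirection_ne_zero ?_) hne
    have := P.vertex_ne (i - 1)
    rw [sub_add_cancel] at this
    exact this.symm
  have hdir : ∀ k, geodesicDirection (P.vertex k) (P.vertex (k - 1)) =
      P.cornerRatio i * geodesicDirection (P.vertex k) (P.vertex (k + 1)) := by
    intro k
    rw [h.cornerRatio_eq i k, cornerRatio,
      div_mul_cancel₀ _ (geodesicDirection_ne_zero (P.vertex_ne k))]
  have hstep : ∀ k : ℕ, ((c : ℂ) * P.vertex (i + k) + d) * P.vertex (i + k + 1) =
        a * P.vertex (i + k) + b ∧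
      ((c : ℂ) * P.vertex (i + k + 1) + d) * P.vertex (i + k + 1 + 1) =
        a * P.vertex (i + k + 1) + b := by
    intro k
    induction k with
    | zero => simpa using ⟨h1, h2⟩
    | succ k ih =>
      push_cast
      rw [← add_assoc]
      refine ⟨ih.2, ?_⟩
      have e1 := hdir (i + k + 1)
      have e2 := hdir (i + k + 1 + 1)
      rw [add_sub_cancel_right] at e1 e2
      exact moebius_eq_of_geodesicDirection hdet hq ih.1 ih.2 e1 e2
  have hT : ∀ j : ℤ, ((P.vertex (j + p) : ℍ) : ℂ) = 1 + P.vertex j := by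
    intro j
    rw [P.vertex_add, coe_vadd, Complex.ofReal_one]
  have hper := (hstep p).1
  rw [show i + (p : ℤ) + 1 = i + 1 + p by ring, hT, hT] at hper
  have hcomm : (c : ℂ) * (P.vertex i + P.vertex (i + 1)) + (c + d - a) = 0 := by
    linear_combination hper - h1
  have hc : c = 0 := by
    have := congrArg Complex.im hcomm
    simp only [Complex.add_im, Complex.mul_im, Complex.ofReal_re, Complex.ofReal_im, coe_im,
      Complex.sub_im, zero_mul, add_zero, sub_zero, Complex.zero_im, mul_eq_zero] at this
    refine this.resolve_right ?_
    have := (P.vertex i).im_pos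
    have := (P.vertex (i + 1)).im_pos
    positivity
  subst hc
  simp only [Complex.ofReal_zero, zero_mul, zero_add] at hcomm hstep
  have had : (a : ℂ) = d := by linear_combination -hcomm
  have hd : (d : ℂ) ≠ 0 := by
    intro hd
    rw [Complex.ofReal_eq_zero] at hd
    simp [hd] at hdet
  have hk : ∀ k : ℕ, (P.vertex (i + k) : ℂ) = P.vertex i + k * (b / d) := by
    intro k
    induction k with
    | zero => simp
    | succ k ih =>
      have := (hstep k).1
      rw [ih, had] at this
      push_cast
      rw [← add_assoc]
      field_simp at this ⊢
      linear_combination this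
  have hpp := hk p
  rw [hT, add_comm, add_right_inj] at hpp
  have hbd : (b : ℂ) / d = 1 / p := by
    rw [hpp]
    field_simp
  have hone := hk 1
  ext
  rw [coe_vadd]
  push_cast at hone ⊢
  rw [hone, hbd]
  ring

namespace IsTranslational

variable {P : PolygonalCusp p}

theorem interiorAngle_eq (h : P.IsTranslational) (hp : 1 ≤ p) (i : ℤ) :
    P.interiorAngle i = 2 * Real.arcsin
      (2 * Real.exp (P.perimeter / (2 * p)) / (1 + Real.exp (P.perimeter / p))) := by
  have hp' : (0 : ℝ) < p := by exact_mod_cast hp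
  have hy := (P.vertex 0).im_pos
  have hS := h.sinh_half_sideLength i
  rw [h.sideLength_eq_perimeter_div hp, div_div, mul_comm (p : ℝ) 2] at hS
  have harg : 2 * Real.exp (P.perimeter / (2 * p)) / (1 + Real.exp (P.perimeter / p)) =
      1 / Real.cosh (P.perimeter / (2 * p)) := by
    have : P.perimeter / p = P.perimeter / (2 * p) + P.perimeter / (2 * p) := by
      field_simp
      ring
    rw [this, Real.exp_add, Real.cosh_eq, Real.exp_neg]
    have := Real.exp_pos (P.perimeter / (2 * p))
    field_simp
    ring
  rw [harg]
  set S := Real.sinh (P.perimeter / (2 * p)) with hSdef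
  set C := Real.cosh (P.perimeter / (2 * p)) with hCdef
  have hC : 0 < C := Real.cosh_pos _
  have hCS : C ^ 2 = S ^ 2 + 1 := Real.cosh_sq _
  have hSpos : 0 < S := by
    rw [hS]
    positivity
  have hC1 : 1 ≤ C := Real.one_le_cosh _
  have ht : 1 / (p : ℝ) = 2 * (P.vertex 0).im * S := by
    rw [hS]
    field_simp
  set φ := Real.arcsin (1 / C) with hφ
  have hsin : Real.sin φ = 1 / C :=
    Real.sin_arcsin (by linarith [show (0 : ℝ) ≤ 1 / C by positivity])
      ((div_le_one hC).2 hC1)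
  have hcos : Real.cos φ = S / C := by
    rw [hφ, Real.cos_arcsin, show 1 - (1 / C) ^ 2 = (S / C) ^ 2 by
      field_simp
      linarith, Real.sqrt_sq (by positivity)]
  have hφ0 : 0 ≤ φ := Real.arcsin_nonneg.2 (by positivity)
  have hφ1 : φ < Real.pi / 2 := Real.arcsin_lt_pi_div_two.2 ((div_lt_one hC).2 (by nlinarith))
  have hnext := h i
  have hprev := h (i - 1)
  rw [sub_add_cancel] at hprev
  have him : ((P.vertex i : ℍ) : ℂ) - (starRingEnd ℂ) (P.vertex i) =
      2 * (P.vertex 0).im * Complex.I := by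
    rw [Complex.sub_conj, coe_im, h.im_vertex]
    push_cast
    rfl
  have hratio : P.cornerRatio i = Real.cos (2 * φ) + Real.sin (2 * φ) * Complex.I := by
    have e1 : ((P.vertex (i + 1) : ℍ) : ℂ) = P.vertex i + 2 * (P.vertex 0).im * S := by
      rw [hnext, coe_vadd, ht]
      push_cast
      ring
    have e2 : ((P.vertex (i - 1) : ℍ) : ℂ) = P.vertex i - 2 * (P.vertex 0).im * S := by
      rw [hprev, coe_vadd, ht]
      push_cast
      ring
    have e3 : ((P.vertex i : ℍ) : ℂ) + 2 * (P.vertex 0).im * S - (starRingEnd ℂ) (P.vertex i) =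
        2 * (P.vertex 0).im * (S + Complex.I) := by linear_combination him
    have e4 : ((P.vertex i : ℍ) : ℂ) - 2 * (P.vertex 0).im * S - (starRingEnd ℂ) (P.vertex i) =
        -(2 * (P.vertex 0).im * (S - Complex.I)) := by linear_combination him
    rw [cornerRatio, geodesicDirection, geodesicDirection, e1, e2, e3, e4, Real.cos_two_mul,
      Real.sin_two_mul, hsin, hcos]
    have n0 : ((P.vertex 0).im : ℂ) ≠ 0 := by exact_mod_cast hy.ne'
    have n1 : (S : ℂ) ≠ 0 := by exact_mod_cast hSpos.ne'
    have n2 : (C : ℂ) ≠ 0 := by exact_mod_cast hC.ne'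
    have n3 : (S : ℂ) + Complex.I ≠ 0 := fun h0 => by simpa using congrArg Complex.im h0
    have n4 : (S : ℂ) - Complex.I ≠ 0 := fun h0 => by simpa using congrArg Complex.im h0
    have hI := Complex.I_ne_zero
    have hI2 := Complex.I_sq
    have hCS' : (C : ℂ) ^ 2 = S ^ 2 + 1 := by exact_mod_cast hCS
    rw [add_sub_cancel_left, sub_sub_cancel_left]
    push_cast
    field_simp
    rw [hCS']
    ring_nf
    simp only [hI2]
    ring
  change toIcoMod Real.two_pi_pos 0 (Complex.arg (P.cornerRatio i)) = _
  have hpi := Real.pi_pos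
  rw [hratio, Complex.ofReal_cos, Complex.ofReal_sin,
    Complex.arg_cos_add_sin_mul_I ⟨by linarith, by linarith⟩, toIcoMod_eq_self]
  exact ⟨by linarith, by linarith⟩

theorem isRegular (h : P.IsTranslational) (hp : 1 ≤ p) : P.IsRegular :=
  ⟨h.sideLength_eq, fun i j => by rw [h.interiorAngle_eq hp i, h.interiorAngle_eq hp j]⟩

end IsTranslational

end PolygonalCusp

/-! ### Construction of a regular cusp -/

namespace UpperHalfPlane

theorem continuous_fract_sub_half_sq : Continuous fun x : ℝ => (Int.fract x - 1 / 2) ^ 2 :=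
  ContinuousOn.comp_fract'' (f := fun x : ℝ => (x - 1 / 2) ^ 2) (by fun_prop) (by norm_num)

/-- The square of the Euclidean distance from `z` to the nearest of the points `(i + 1 / 2) / p`
of the real axis. -/
noncomputable def sqDistCenters (p : ℕ) (z : ℍ) : ℝ :=
  (Int.fract (p * z.re) - 1 / 2) ^ 2 / p ^ 2 + z.im ^ 2

theorem continuous_sqDistCenters (p : ℕ) : Continuous (sqDistCenters p) := by
  have h1 : Continuous fun z : ℍ => (p : ℝ) * z.re := continuous_re.const_mul _
  exact ((continuous_fract_sub_half_sq.comp h1).div_const _).add (continuous_im.pow 2)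

theorem sqDistCenters_eq {p : ℕ} (hp : 1 ≤ p) {z : ℍ} {i : ℤ} (h1 : i / p ≤ z.re)
    (h2 : z.re ≤ (i + 1) / p) :
    sqDistCenters p z = (z.re - (i + 1 / 2) / p) ^ 2 + z.im ^ 2 := by
  have hp' : (0 : ℝ) < p := by exact_mod_cast hp
  rw [div_le_iff₀ hp'] at h1
  rw [le_div_iff₀ hp'] at h2
  rw [sqDistCenters]
  rcases h2.eq_or_lt with h | h
  · have : Int.fract (p * z.re) = 0 := by
      rw [mul_comm, h]
      exact_mod_cast Int.fract_intCast (i + 1)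
    rw [this, show z.re = (i + 1) / p by
      rw [eq_div_iff hp'.ne', h]]
    field_simp
    ring
  · have : ⌊(p : ℝ) * z.re⌋ = i := Int.floor_eq_iff.2 ⟨by linarith, by linarith⟩
    rw [Int.fract, this]
    field_simp
    ring

end UpperHalfPlane

namespace PolygonalCusp

variable {p : ℕ}

/-- The vertices `i / p + y * I` on a horocycle. -/
noncomputable def horocyclicVertex (p : ℕ) (y : ℝ) (hy : 0 < y) (i : ℤ) : ℍ :=
  ⟨⟨i / p, y⟩, hy⟩

/-- The side from `i / p + y * I` to `(i + 1) / p + y * I` is an arc of the level set of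
`sqDistCenters p` whose value is the squared radius of the circles through successive vertices. -/
theorem mem_geodesicSegment_horocyclicVertex (hp : 1 ≤ p) {y : ℝ} (hy : 0 < y) (i : ℤ) (u : ℍ) :
    u ∈ geodesicSegment (horocyclicVertex p y hy i) (horocyclicVertex p y hy (i + 1)) ↔
      i / p ≤ u.re ∧ u.re ≤ (i + 1) / p ∧ sqDistCenters p u = (1 / 2) ^ 2 / p ^ 2 + y ^ 2 := by
  have hp' : (0 : ℝ) < p := by exact_mod_cast hp
  have hre : ∀ j : ℤ, (horocyclicVertex p y hy j).re = j / p := fun _ => rfl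
  have him : ∀ j : ℤ, (horocyclicVertex p y hy j).im = y := fun _ => rfl
  have hlt : (horocyclicVertex p y hy i).re < (horocyclicVertex p y hy (i + 1)).re := by
    rw [hre, hre, div_lt_div_iff_of_pos_right hp']
    push_cast
    linarith
  have hc : geodesicCenter (horocyclicVertex p y hy i) (horocyclicVertex p y hy (i + 1)) =
      (i + 1 / 2) / p := by
    rw [geodesicCenter, hre, hre, him, him]
    push_cast
    field_simp
    ring
  have hrad : ((i : ℝ) / p - (i + 1 / 2) / p) ^ 2 + y ^ 2 = (1 / 2) ^ 2 / p ^ 2 + y ^ 2 := by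
    field_simp
    ring
  have hspec := geodesicCenter_spec hlt.ne
  constructor
  · intro hu
    have h1 := mem_geodesicSegment_of_lt hlt hu
    have h2 := mem_circle_of_mem_geodesicSegment hlt.ne hu
    rw [hre, hre] at h1
    push_cast at h1
    rw [hc, hre, him, hrad] at h2
    exact ⟨h1.1, h1.2, by rw [sqDistCenters_eq hp h1.1 h1.2, h2]⟩
  · rintro ⟨h1, h2, h3⟩
    rw [sqDistCenters_eq hp h1 h2, ← hrad] at h3
    rw [hc] at hspec
    refine mem_geodesicSegment_of_circle hspec.symm h3 h1 ?_
    rw [hre]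
    push_cast
    exact h2

theorem exists_mem_Icc_div (hp : 1 ≤ p) (x : ℝ) : ∃ i : ℤ, i / p ≤ x ∧ x ≤ (i + 1) / p := by
  have hp' : (0 : ℝ) < p := by exact_mod_cast hp
  refine ⟨⌊p * x⌋, ?_, ?_⟩
  · rw [div_le_iff₀ hp', mul_comm]
    exact Int.floor_le _
  · rw [le_div_iff₀ hp', mul_comm x]
    exact (Int.lt_floor_add_one _).le

theorem isConnected_lt_sqDistCenters (hp : 1 ≤ p) {y : ℝ} (hy : 0 < y) :
    IsConnected {z : ℍ | (1 / 2) ^ 2 / (p : ℝ) ^ 2 + y ^ 2 < sqDistCenters p z} := by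
  have hp' : (0 : ℝ) < p := by exact_mod_cast hp
  -- the height of the boundary curve, squared
  let g : ℝ → ℝ := fun x => (1 / 2) ^ 2 / (p : ℝ) ^ 2 + y ^ 2 -
    (Int.fract (p * x) - 1 / 2) ^ 2 / p ^ 2
  have hg : Continuous g := continuous_const.sub
    ((continuous_fract_sub_half_sq.comp (continuous_const.mul continuous_id)).div_const _)
  have hgpos : ∀ x, 0 < g x := by
    intro x
    have h0 := Int.fract_nonneg (p * x)
    have h1 := (Int.fract_lt_one (p * x)).le
    have h2 : (Int.fract (p * x) - 1 / 2) ^ 2 / (p : ℝ) ^ 2 ≤ (1 / 2) ^ 2 / (p : ℝ) ^ 2 :=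
      div_le_div_of_nonneg_right (by nlinarith) (by positivity)
    have : 0 < y ^ 2 := by positivity
    change 0 < _ - _
    linarith
  let F : ℝ × ℝ → ℂ := fun q => q.1 + √(g q.1 + q.2) * Complex.I
  have hF : Continuous F := by fun_prop
  have hFre : ∀ q, (F q).re = q.1 := fun q => by simp [F]
  have hFim : ∀ q, (F q).im = √(g q.1 + q.2) := fun q => by simp [F]
  have himg : ((↑) : ℍ → ℂ) '' {z : ℍ | (1 / 2) ^ 2 / (p : ℝ) ^ 2 + y ^ 2 < sqDistCenters p z} =
      F '' (Set.univ ×ˢ Set.Ioi 0) := by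
    ext w
    constructor
    · rintro ⟨z, hz, rfl⟩
      have hz' : g z.re < z.im ^ 2 := sub_lt_iff_lt_add'.2 hz
      refine ⟨(z.re, z.im ^ 2 - g z.re), ⟨trivial, sub_pos.2 hz'⟩, Complex.ext (hFre _) ?_⟩
      rw [hFim, add_sub_cancel, Real.sqrt_sq z.im_pos.le, coe_im]
    · rintro ⟨q, ⟨-, hq⟩, rfl⟩
      have hq' : 0 < q.2 := hq
      have hpos := add_pos (hgpos q.1) hq'
      refine ⟨⟨F q, by rw [hFim]; exact Real.sqrt_pos.2 hpos⟩, ?_, rfl⟩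
      have hlt : g (F q).re < (F q).im ^ 2 := by
        rw [hFre, hFim, Real.sq_sqrt hpos.le]
        linarith
      exact sub_lt_iff_lt_add'.1 hlt
  have hconn : IsConnected (F '' (Set.univ ×ˢ Set.Ioi 0)) :=
    (isConnected_univ.prod isConnected_Ioi).image F hF.continuousOn
  rw [← himg] at hconn
  exact ⟨hconn.nonempty.of_image,
    isOpenEmbedding_coe.toIsEmbedding.toIsInducing.isPreconnected_image.1 hconn.isPreconnected⟩

/-- The polygonal cusp with vertices `i / p + y * I`. Its preimage in `ℍ` is the exterior of the
closed discs of centres `(i + 1 / 2) / p` whose boundary circles carry the sides. -/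
noncomputable def horocyclicCusp (hp : 1 ≤ p) {y : ℝ} (hy : 0 < y) : PolygonalCusp p where
  vertex := horocyclicVertex p y hy
  region := {z | (1 / 2) ^ 2 / (p : ℝ) ^ 2 + y ^ 2 < sqDistCenters p z}
  vertex_add i := by
    have hp' : (p : ℝ) ≠ 0 := by exact_mod_cast (by omega : p ≠ 0)
    refine ext_re_im ?_ (vadd_im _ _).symm
    change ((i + (p : ℤ) : ℤ) : ℝ) / p = 1 + (i : ℝ) / p
    push_cast
    field_simp
    ring
  vertex_ne i h := by
    have hp' : (p : ℝ) ≠ 0 := by exact_mod_cast (by omega : p ≠ 0)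
    have : (i : ℝ) / p = ((i + 1 : ℤ) : ℝ) / p := congrArg UpperHalfPlane.re h
    rw [div_left_inj' hp'] at this
    push_cast at this
    linarith
  simple := by
    have hp' : (0 : ℝ) < p := by exact_mod_cast hp
    have key : ∀ (i : ℤ) (u : ℍ), u ∈ geodesicSegment (horocyclicVertex p y hy i)
        (horocyclicVertex p y hy (i + 1)) \ {horocyclicVertex p y hy (i + 1)} →
        ⌊(p : ℝ) * u.re⌋ = i := by
      rintro i u ⟨hu, hne⟩
      rw [mem_geodesicSegment_horocyclicVertex hp] at hu
      obtain ⟨h1, h2, h3⟩ := hu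
      rcases h2.eq_or_lt with h | h
      · refine absurd ?_ hne
        refine ext_re_im (h.trans ?_) ?_
        · change _ = ((i + 1 : ℤ) : ℝ) / p
          push_cast
          rfl
        · change u.im = y
          rw [sqDistCenters_eq hp h1 h2, h] at h3
          have h4 : ((i + 1 : ℝ) / p - (i + 1 / 2) / p) ^ 2 = (1 / 2) ^ 2 / (p : ℝ) ^ 2 := by
            field_simp
            ring
          rw [h4, add_right_inj] at h3
          exact (sq_eq_sq₀ u.im_pos.le hy.le).1 h3
      · rw [div_le_iff₀ hp'] at h1
        rw [lt_div_iff₀ hp'] at h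
        exact Int.floor_eq_iff.2 ⟨by linarith, by linarith⟩
    intro i j hij
    exact Set.disjoint_left.2 fun u hu hu' => hij ((key i u hu).symm.trans (key j u hu'))
  vadd_mem_region z := by
    have : sqDistCenters p ((1 : ℝ) +ᵥ z) = sqDistCenters p z := by
      rw [sqDistCenters, sqDistCenters, vadd_re, vadd_im, mul_add, mul_one, Int.fract_natCast_add]
    rw [Set.mem_ofPred_eq, Set.mem_ofPred_eq, this]
  isOpen_region := isOpen_lt continuous_const (continuous_sqDistCenters p)
  isConnected_region := isConnected_lt_sqDistCenters hp hy
  mem_region_of_lt_im := by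
    refine ⟨(1 / 2) ^ 2 / (p : ℝ) ^ 2 + y ^ 2 + 1, fun z hz => ?_⟩
    have h1 : 0 ≤ (1 / 2) ^ 2 / (p : ℝ) ^ 2 + y ^ 2 := by positivity
    have h2 : 0 ≤ (Int.fract (p * z.re) - 1 / 2) ^ 2 / (p : ℝ) ^ 2 := by positivity
    rw [Set.mem_ofPred_eq, sqDistCenters]
    nlinarith
  im_ge_of_mem_region := by
    refine ⟨y, hy, fun z hz => ?_⟩
    have h0 := Int.fract_nonneg (p * z.re)
    have h1 := (Int.fract_lt_one (p * z.re)).le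
    have h2 : (Int.fract (p * z.re) - 1 / 2) ^ 2 / (p : ℝ) ^ 2 ≤ (1 / 2) ^ 2 / (p : ℝ) ^ 2 :=
      div_le_div_of_nonneg_right (by nlinarith) (by positivity)
    rw [Set.mem_ofPred_eq, sqDistCenters] at hz
    have h3 := z.im_pos
    nlinarith
  frontier_region := by
    have hfr : frontier {z : ℍ | (1 / 2) ^ 2 / (p : ℝ) ^ 2 + y ^ 2 < sqDistCenters p z} =
        {z : ℍ | (1 / 2) ^ 2 / (p : ℝ) ^ 2 + y ^ 2 = sqDistCenters p z} := by
      refine Set.Subset.antisymm (frontier_lt_subset_eq continuous_const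
        (continuous_sqDistCenters p)) fun z hz => ?_
      rw [(isOpen_lt continuous_const (continuous_sqDistCenters p)).frontier_eq]
      refine ⟨?_, fun h => (ne_of_lt h) hz⟩
      have hlim : Filter.Tendsto (fun t : ℝ => UpperHalfPlane.mk ⟨z.re, Real.exp t⟩ t.exp_pos)
          (nhdsWithin (Real.log z.im) (Set.Ioi (Real.log z.im))) (nhds z) := by
        have hcont := ((isometry_vertical_line z.re).continuous.tendsto (Real.log z.im)).mono_left
          (nhdsWithin_le_nhds (s := Set.Ioi (Real.log z.im)))
        refine hcont.trans (le_of_eq (congrArg nhds (ext_re_im rfl ?_)))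
        exact Real.exp_log z.im_pos
      refine mem_closure_of_tendsto hlim ?_
      filter_upwards [self_mem_nhdsWithin] with t ht
      have hexp : z.im < Real.exp t := (Real.log_lt_iff_lt_exp z.im_pos).1 ht
      have hz' : (1 / 2) ^ 2 / (p : ℝ) ^ 2 + y ^ 2 =
        (Int.fract (p * z.re) - 1 / 2) ^ 2 / p ^ 2 + z.im ^ 2 := hz
      change _ < (Int.fract (p * z.re) - 1 / 2) ^ 2 / (p : ℝ) ^ 2 + Real.exp t ^ 2
      rw [hz']
      have := z.im_pos
      nlinarith
    rw [hfr]
    ext u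
    rw [Set.mem_iUnion, Set.mem_ofPred_eq]
    constructor
    · intro hu
      obtain ⟨i, h1, h2⟩ := exists_mem_Icc_div hp u.re
      exact ⟨i, (mem_geodesicSegment_horocyclicVertex hp hy i u).2 ⟨h1, h2, hu.symm⟩⟩
    · rintro ⟨i, hi⟩
      exact ((mem_geodesicSegment_horocyclicVertex hp hy i u).1 hi).2.2.symm

theorem isTranslational_horocyclicCusp (hp : 1 ≤ p) {y : ℝ} (hy : 0 < y) :
    (horocyclicCusp hp hy).IsTranslational := by
  intro i
  refine ext_re_im ?_ (vadd_im _ _).symm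
  change ((i + 1 : ℤ) : ℝ) / p = 1 / p + (i : ℝ) / p
  push_cast
  ring

/-- The height of the vertices is chosen such that the sides have length `L / p`. -/
theorem exists_isTranslational (hp : 1 ≤ p) {L : ℝ} (hL : 0 < L) :
    ∃ P : PolygonalCusp p, P.perimeter = L ∧ P.IsTranslational := by
  have hp' : (0 : ℝ) < p := by exact_mod_cast hp
  have hs : 0 < Real.sinh (L / p / 2) := Real.sinh_pos_iff.2 (by positivity)
  have hy : 0 < 1 / p / (2 * Real.sinh (L / p / 2)) := by positivity
  have hT := isTranslational_horocyclicCusp hp hy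
  refine ⟨horocyclicCusp hp hy, ?_, hT⟩
  have h1 := hT.sinh_half_sideLength 0
  have h2 : ((horocyclicCusp hp hy).vertex 0).im = 1 / p / (2 * Real.sinh (L / p / 2)) := rfl
  have h3 : 1 / (p : ℝ) / (2 * (1 / p / (2 * Real.sinh (L / p / 2)))) =
      Real.sinh (L / p / 2) := by
    field_simp
  rw [h2, h3, hT.sideLength_eq_perimeter_div hp] at h1
  have h4 := Real.sinh_injective h1
  exact (div_left_inj' hp'.ne').1 ((div_left_inj' two_ne_zero).1 h4)

end PolygonalCusp

/-! ### The isoperimetric inequality and its equality case -/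

namespace PolygonalCusp

variable {p : ℕ}

theorem vertex_injective (P : PolygonalCusp p) : Function.Injective P.vertex := by
  intro i j hij
  by_contra hne
  refine Set.disjoint_left.1 (P.simple hne) ⟨left_mem_geodesicSegment _ _, P.vertex_ne i⟩
    ⟨?_, ?_⟩
  · rw [hij]
    exact left_mem_geodesicSegment _ _
  · rw [hij]
    exact P.vertex_ne j

/-- Jensen's inequality for `sideArea`, with its equality case. -/
theorem sum_sideArea_le (P : PolygonalCusp p) (hp : 1 ≤ p) :
    ∑ i ∈ Finset.range p, sideArea (P.sideLength i) ≤ p * sideArea (P.perimeter / p) ∧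
      (∑ i ∈ Finset.range p, sideArea (P.sideLength i) = p * sideArea (P.perimeter / p) →
        ∀ i < p, P.sideLength i = P.perimeter / p) := by
  have hp' : (0 : ℝ) < p := by exact_mod_cast hp
  have hw : ∑ _i ∈ Finset.range p, (1 / p : ℝ) = 1 := by
    rw [Finset.sum_const, Finset.card_range, nsmul_eq_mul]
    field_simp
  have hmem : ∀ i ∈ Finset.range p, P.sideLength (i : ℕ) ∈ Set.Ici (0 : ℝ) :=
    fun i _ => Set.mem_Ici.2 dist_nonneg
  have hmean : ∑ i ∈ Finset.range p, (1 / p : ℝ) • P.sideLength (i : ℕ) = P.perimeter / p := by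
    rw [← Finset.smul_sum, smul_eq_mul, perimeter]
    ring
  have harea : ∑ i ∈ Finset.range p, (1 / p : ℝ) • sideArea (P.sideLength (i : ℕ)) =
      (∑ i ∈ Finset.range p, sideArea (P.sideLength i)) / p := by
    rw [← Finset.smul_sum, smul_eq_mul]
    ring
  constructor
  · have := strictConcaveOn_sideArea.concaveOn.le_map_sum (fun _ _ => by positivity) hw hmem
    rw [hmean, harea, div_le_iff₀ hp'] at this
    linarith
  · intro heq i hi
    have h := (strictConcaveOn_sideArea.lt_map_sum_iff_of_pos' (fun _ _ => by positivity) hw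
      hmem).not.1 (by
        rw [hmean, harea, heq]
        field_simp
        exact lt_irrefl _)
    rw [hmean] at h
    by_contra hne
    exact h ⟨i, Finset.mem_range.2 hi, hne⟩

theorem area_le (P : PolygonalCusp p) (hp : 1 ≤ p) :
    P.area ≤ ENNReal.ofReal (p * sideArea (P.perimeter / p)) := by
  refine (P.area_le_sum hp).trans ?_
  rw [← ENNReal.ofReal_sum_of_nonneg fun i _ => ?_]
  · exact ENNReal.ofReal_le_ofReal ((Finset.sum_le_sum fun i _ =>
      two_mul_arctan_le_sideArea _ _).trans (P.sum_sideArea_le hp).1)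
  · have := (P.vertex i).im_pos
    have := (P.vertex (i + 1)).im_pos
    exact mul_nonneg zero_le_two (Real.arctan_nonneg.2 (by positivity))

/-- Horizontal displacements of the sides have equal absolute values, and a change of sign would
make the boundary curve return to a vertex. -/
theorem isTranslational_of_forall_eq (P : PolygonalCusp p) (hp : 1 ≤ p)
    (hlen : ∀ i, P.sideLength i = P.sideLength 0)
    (him : ∀ i, (P.vertex i).im = (P.vertex (i + 1)).im) : P.IsTranslational := by
  have hp' : (p : ℝ) ≠ 0 := by exact_mod_cast (by omega : p ≠ 0)
  have him0 : ∀ i, (P.vertex i).im = (P.vertex 0).im := by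
    intro i
    induction i using Int.induction_on with
    | zero => rfl
    | succ k ih => rw [← him, ih]
    | pred k ih => rw [him, sub_add_cancel, ih]
  have hy := (P.vertex 0).im_pos
  have hsq : ∀ i, ((P.vertex i).re - (P.vertex (i + 1)).re) ^ 2 =
      4 * (P.vertex 0).im ^ 2 * Real.sinh (P.sideLength 0 / 2) ^ 2 := by
    intro i
    rw [← hlen i, sideLength, sinh_half_dist_sq, him0 (i + 1), him0 i]
    field_simp
    ring
  have hstep : ∀ i, (P.vertex (i + 1 + 1)).re - (P.vertex (i + 1)).re =
      (P.vertex (i + 1)).re - (P.vertex i).re := by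
    intro i
    rcases sq_eq_sq_iff_eq_or_eq_neg.1 ((hsq (i + 1)).trans (hsq i).symm) with h | h
    · linarith
    · have : P.vertex (i + 1 + 1) = P.vertex i :=
        ext_re_im (by linarith) (by rw [him0, him0 i])
      have := P.vertex_injective this
      omega
  have hD : ∀ i, (P.vertex (i + 1)).re - (P.vertex i).re =
      (P.vertex 1).re - (P.vertex 0).re := by
    intro i
    induction i using Int.induction_on with
    | zero => rfl
    | succ k ih => rw [hstep, ih]
    | pred k ih =>
      have := hstep (-(k : ℤ) - 1)
      rw [sub_add_cancel, ih] at this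
      rw [sub_add_cancel, this]
  have hk : ∀ k : ℕ, (P.vertex k).re =
      (P.vertex 0).re + k * ((P.vertex 1).re - (P.vertex 0).re) := by
    intro k
    induction k with
    | zero => simp
    | succ k ih =>
      push_cast
      linear_combination ih + hD k
  have hpp := hk p
  have hT := congrArg UpperHalfPlane.re (P.vertex_add 0)
  rw [zero_add, vadd_re] at hT
  intro i
  refine ext_re_im ?_ ?_
  · rw [vadd_re]
    have := hD i
    field_simp
    linear_combination (p : ℝ) * this + hT - hpp
  · rw [vadd_im, ← him]

/-- A cusp of the largest area has equality in Jensen's inequality, so its sides have equal lengths,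
and in the bound of the area above each side, so its vertices have equal heights. -/
theorem isTranslational_of_le_area (P : PolygonalCusp p) (hp : 1 ≤ p)
    (h : ENNReal.ofReal (p * sideArea (P.perimeter / p)) ≤ P.area) : P.IsTranslational := by
  have hp0 : (p : ℤ) ≠ 0 := by exact_mod_cast (by omega : p ≠ 0)
  have hnonneg : ∀ i : ℤ, 0 ≤ 2 * Real.arctan (|(P.vertex (i + 1)).re - (P.vertex i).re| /
      ((P.vertex i).im + (P.vertex (i + 1)).im)) := by
    intro i
    have := (P.vertex i).im_pos
    have := (P.vertex (i + 1)).im_pos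
    exact mul_nonneg zero_le_two (Real.arctan_nonneg.2 (by positivity))
  have h1 := h.trans (P.area_le_sum hp)
  rw [← ENNReal.ofReal_sum_of_nonneg fun (i : ℕ) _ => hnonneg i,
    ENNReal.ofReal_le_ofReal_iff (Finset.sum_nonneg fun (i : ℕ) _ => hnonneg i)] at h1
  have h2 : ∀ i ∈ Finset.range p, 2 * Real.arctan (|(P.vertex ((i : ℕ) + 1)).re -
      (P.vertex i).re| / ((P.vertex i).im + (P.vertex (i + 1)).im)) ≤
      sideArea (P.sideLength i) := fun i _ => two_mul_arctan_le_sideArea _ _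
  have h3 := P.sum_sideArea_le hp
  have h4 := (Finset.sum_eq_sum_iff_of_le h2).1
    (le_antisymm (Finset.sum_le_sum h2) (h3.1.trans h1))
  have h5 := h3.2 (le_antisymm h3.1 (h1.trans (Finset.sum_le_sum h2)))
  -- what holds for one period of sides holds for all sides
  have hall : ∀ i : ℤ, P.sideLength i = P.perimeter / p ∧
      (P.vertex i).im = (P.vertex (i + 1)).im := by
    intro i
    have hi2 : i = i % p + i / p * p := (Int.emod_add_ediv_mul i p).symm
    obtain ⟨r, hr⟩ := Int.eq_ofNat_of_zero_le (Int.emod_nonneg i hp0)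
    have hrp : r < p := by
      have := Int.emod_lt_of_pos i (show (0 : ℤ) < p by omega)
      omega
    generalize i / (p : ℤ) = k at hi2
    rw [hr] at hi2
    subst hi2
    have hs : (r : ℤ) + k * p + 1 = r + 1 + k * p := by ring
    rw [sideLength, hs, P.vertex_add_mul, P.vertex_add_mul, (isometry_real_vadd _).dist_eq,
      vadd_im, vadd_im]
    exact ⟨h5 r hrp, im_eq_of_two_mul_arctan_eq_sideArea (h4 r (Finset.mem_range.2 hrp))⟩
  exact P.isTranslational_of_forall_eq hp (fun i => (hall i).1.trans (hall 0).1.symm)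
    fun i => (hall i).2

end PolygonalCusp

theorem theorem1p2 (p : ℕ) (hp : 1 ≤ p) (L : ℝ) (hL : 0 < L) :
    (∃ P : PolygonalCusp p, P.perimeter = L ∧ P.IsRegular) ∧
      ∀ P : PolygonalCusp p, P.perimeter = L → P.IsRegular →
        (∀ i : ℤ, P.interiorAngle i =
          2 * Real.arcsin (2 * Real.exp (L / (2 * p)) / (1 + Real.exp (L / p)))) ∧
        ∀ Q : PolygonalCusp p, Q.perimeter = L →
          Q.area ≤ P.area ∧ (Q.area = P.area → Q.IsRegular) := by
  refine ⟨?_, fun P hPL hP => ?_⟩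
  · obtain ⟨P, hPL, hP⟩ := PolygonalCusp.exists_isTranslational hp hL
    exact ⟨P, hPL, hP.isRegular hp⟩
  · have hT := hP.isTranslational hp
    subst hPL
    refine ⟨hT.interiorAngle_eq hp, fun Q hQ => ?_⟩
    rw [hT.area_eq hp, ← hQ]
    exact ⟨Q.area_le hp, fun h => (Q.isTranslational_of_le_area hp h.ge).isRegular hp⟩
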